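/- All graphs are finite, simple, undirected and nonempty. The hypercube $Q_k$ has as vertices the $0$-$1$ sequences of length $k$, two being adjacent when they differ in exactly one position. A subgraph $H$ of a graph $G$ is isometric if $d_H(u,v)=d_G(u,v)$ for all vertices $u,v$ of $H$, and convex if moreover every shortest $u,v$-path of $G$ between vertices $u,v$ of $H$ is contained in $H$. A partial cube is a graph isomorphic to an isometric subgraph of some $Q_n$. A convex cycle of $G$ is a cycle of $G$ that is a convex subgraph; an $m$-cycle is a cycle with $m$ edges. For $k\ge 1$ the Doubled Odd graph $\tilde O_k$ is the bipartite graph whose two parts are the $(k-1)$-subsets and the $k$-subsets of $\{1,\dots,2k-1\}$, where a $(k-1)$-subset $u$ and a $k$-subset $v$ are adjacent if and only if $u\subset v$. **Theorem.** Let $G$ be a finite regular partial cube that is not isomorphic to $K_1$ or $K_2$. Then: (i) all convex cycles of $G$ are $4$-cycles if and only if $G\cong Q_k$ for some $k\ge 2$; (ii) all convex cycles of $G$ are $6$-cycles if and only if $G\cong\tilde O_k$ for some $k\ge 2$; (iii) for every $n\ge 4$, all convex cycles of $G$ are $2n$-cycles if and only if $G$ is isomorphic to the cycle $C_{2n}$.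 -/

import Mathlib

/-- The `n`-cube `Q_n`: the vertices are the 0-1 sequences of length `n`, and two of them are
adjacent when they differ in exactly one position. -/
def hypercubeGraph (n : ℕ) : SimpleGraph (Fin n → Bool) where
  Adj x y := hammingDist x y = 1
  symm := ⟨fun x y h => by rw [hammingDist_comm]; exact h⟩
  loopless := ⟨fun x h => by simp at h⟩

/-- The Doubled Odd graph `Õ_k` (`k ≥ 1`): its two parts are the `(k-1)`-subsets and the
`k`-subsets of a `(2k-1)`-element set, and adjacency is inclusion between the parts. -/
def doubledOddGraph (k : ℕ) :
    SimpleGraph {s : Finset (Fin (2 * k - 1)) // s.card = k - 1 ∨ s.card = k} where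
  Adj s t :=
    (s.1.card = k - 1 ∧ t.1.card = k ∧ s.1 ⊂ t.1) ∨
      (t.1.card = k - 1 ∧ s.1.card = k ∧ t.1 ⊂ s.1)
  symm := ⟨fun _ _ h => h.symm⟩
  loopless := ⟨fun s h => by
    rcases h with h | h
    · exact (lt_irrefl s.1) h.2.2
    · exact (lt_irrefl s.1) h.2.2⟩

/-- A subgraph is isometric when distances inside it agree with distances in the whole graph.
Distances take values in `ℕ∞`, with `⊤` for vertices in different components. -/
def SimpleGraph.Subgraph.IsIsometric {V : Type*} {G : SimpleGraph V} (H : G.Subgraph) : Prop :=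
  ∀ u v : H.verts, H.coe.edist u v = G.edist (u : V) (v : V)

/-- A subgraph is convex when it is isometric and contains every geodesic of the whole graph
between two of its vertices. A walk whose length is the distance of its ends is a geodesic. -/
def SimpleGraph.Subgraph.IsConvex {V : Type*} {G : SimpleGraph V} (H : G.Subgraph) : Prop :=
  H.IsIsometric ∧
    ∀ u ∈ H.verts, ∀ v ∈ H.verts, ∀ p : G.Walk u v, p.length = G.dist u v → p.toSubgraph ≤ H

/-- A partial cube is a graph isomorphic to an isometric subgraph of some hypercube. -/
def SimpleGraph.IsPartialCube {V : Type*} (G : SimpleGraph V) : Prop :=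
  ∃ (n : ℕ) (H : (hypercubeGraph n).Subgraph), H.IsIsometric ∧ Nonempty (G ≃g H.coe)

/-- Every convex cycle of `G` has length `m`. -/
def SimpleGraph.AllConvexCyclesHaveLength {V : Type*} (G : SimpleGraph V) (m : ℕ) : Prop :=
  ∀ (v : V) (c : G.Walk v v), c.IsCycle → c.toSubgraph.IsConvex → c.length = m

/-!
A partial cube is coded as an isometric family `S` of finite sets, adjacency being the flip of one
element, so that distances are cardinalities of symmetric differences and each edge has a
direction.

*Convex cycles.* Take two edges of direction `i`, with ends `a`, `c` on the same side, such that no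
third edge of direction `i` lies between them. Every geodesic inside the subcube they span which
changes sides does so along one of the two edges. This forces vertices at complementary distances on
the two sides to have complementary positions, so on each side the vertices form a single path, and
the subcube meets `S` in a convex cycle of length `2 * (#(a ∆ c) + 1)`
(`IsCubeCoding.exists_convex_cycle`). Hence if all convex cycles have length `2 * (k + 1)`,
consecutive edges of equal direction are always at distance `k` (`HasGap`), any two edges of equal
direction are at distance at least `k`, and geodesics of length at most `k` are unique.

*The role of regularity.* Fix a vertex `w`, and among the vertices from which the interval to `w`
starts as a path of length `k`, take a farthest one `x`, with path from `x` to `u`. Each neighbour of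
`x` away from `w` has a second neighbour towards `w`, hence lies with the path on a convex cycle.
So `u` has as many directions away from `w` as its degree allows, which is only possible for `u = w`.
It follows (`opposite_flip_mem`) that every path with `k + 1` edges lies in a convex cycle, in the
form: if `x` and `w` are at distance `k`, every direction at `x` which leads away from `w` is a
direction at `w`.

*Conclusion.* For `k = 1` all vertices have the same directions, and the graph is a hypercube. For
`k = 2` there are disjoint sets `A`, `B` of `d` and `d - 1` directions such that `A` is the set of
directions at a given vertex and `B` together with the direction back is that of each neighbour;
following how these sets change along edges identifies the vertices with the `(d - 1)`- and
`d`-subsets of `A ∪ B`. For `k ≥ 3` and degree at least `3`, two prolongations of one path of length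
`k` would give two edges of equal direction at distance two; so the degree is `2` and the graph is
one of its convex cycles.

Conversely, a convex cycle contains every geodesic between its vertices. In a hypercube a path with
two edges, and in a Doubled Odd graph a path with three edges, has a second geodesic between its
ends. The two geodesics form a cycle inside the convex cycle, which is therefore all of it
(`SimpleGraph.Walk.IsCycle.length_eq_of_toSubgraph_le`).
-/

open scoped symmDiff Finset

/-! ### Isometric families of finite sets -/

/-- A family of finite sets is isometric when one can walk inside it from any member to any
other one by geodesics of the cube: some single flip of `u` in a coordinate where `u` and `v`
differ stays in the family. -/
def IsometricFamily {ι : Type*} [DecidableEq ι] (S : Set (Finset ι)) : Prop :=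
  ∀ u ∈ S, ∀ v ∈ S, u ≠ v → ∃ i ∈ u ∆ v, u ∆ {i} ∈ S

/-- The vertices `a` and `c` are the ends, on the same side, of two different edges of direction
`i`, and no third edge of direction `i` has its end on this side in the interval from `a`
to `c`. -/
structure ConsecutiveEdges {ι : Type*} [DecidableEq ι] (S : Set (Finset ι)) (i : ι)
    (a c : Finset ι) : Prop where
  left_mem : a ∈ S
  left_flip_mem : a ∆ {i} ∈ S
  right_mem : c ∈ S
  right_flip_mem : c ∆ {i} ∈ S
  ne : a ≠ c
  same_side : i ∉ a ∆ c
  between : ∀ z ∈ S, z ∆ {i} ∈ S → a ∆ z ⊆ a ∆ c → z = a ∨ z = c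

/-- Any two consecutive edges of equal direction are at distance `k`. -/
def HasGap {ι : Type*} [DecidableEq ι] (S : Set (Finset ι)) (k : ℕ) : Prop :=
  ∀ i a c, ConsecutiveEdges S i a c → #(a ∆ c) = k

/-- Up to distance `m` from `x`, the interval from `x` to `w` has at most one vertex at each
distance from `x`. -/
def IsChainUpTo {ι : Type*} [DecidableEq ι] (S : Set (Finset ι)) (x w : Finset ι) (m : ℕ) : Prop :=
  ∀ u ∈ S, ∀ u' ∈ S, x ∆ u ⊆ x ∆ w → x ∆ u' ⊆ x ∆ w → #(x ∆ u) = #(x ∆ u') → #(x ∆ u) ≤ m → u = u'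

section Family

variable {ι : Type*} [DecidableEq ι] {S : Set (Finset ι)} {k m : ℕ} {u v w x a c : Finset ι}
  {i s : ι}

lemma symmDiff_symmDiff_singleton_of_notMem (h : i ∉ u ∆ v) :
    u ∆ (v ∆ {i}) = insert i (u ∆ v) := by
  ext t; grind [Finset.mem_symmDiff]

lemma symmDiff_singleton_symmDiff_of_mem (h : i ∈ u ∆ v) :
    (u ∆ {i}) ∆ v = (u ∆ v).erase i := by
  ext t; grind [Finset.mem_symmDiff]

lemma symmDiff_singleton_symmDiff_of_notMem (h : i ∉ u ∆ v) :
    (u ∆ {i}) ∆ v = insert i (u ∆ v) := by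
  ext t; grind [Finset.mem_symmDiff]

/-- A geodesic from `u` to `v` crosses every direction `i` in which they differ; `z` is the near end
of the crossing edge. -/
lemma IsometricFamily.exists_edge_of_mem_symmDiff (hS : IsometricFamily S) :
    ∀ {u v : Finset ι}, u ∈ S → v ∈ S → i ∈ u ∆ v →
      ∃ z ∈ S, z ∆ {i} ∈ S ∧ i ∉ u ∆ z ∧ u ∆ z ⊆ u ∆ v := by
  suffices ∀ n, ∀ u v : Finset ι, #(u ∆ v) = n → u ∈ S → v ∈ S → i ∈ u ∆ v →
      ∃ z ∈ S, z ∆ {i} ∈ S ∧ i ∉ u ∆ z ∧ u ∆ z ⊆ u ∆ v from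
    fun {u v} hu hv h => this _ u v rfl hu hv h
  intro n
  induction n with
  | zero => intro u v hn hu hv h; simp_all
  | succ n ih =>
    intro u v hn hu hv h
    obtain ⟨j, hj, hju⟩ := hS u hu v hv (by rintro rfl; simp at h)
    by_cases hij : j = i
    · subst hij
      exact ⟨u, hu, hju, by simp, by simp⟩
    · have he := symmDiff_singleton_symmDiff_of_mem hj
      obtain ⟨z, hz, hzi, h1, h2⟩ := ih (u ∆ {j}) v
        (by rw [he, Finset.card_erase_of_mem hj, hn]; rfl) hju hv
        (by rw [he]; exact Finset.mem_erase.2 ⟨Ne.symm hij, h⟩)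
      rw [he] at h2
      refine ⟨z, hz, hzi, ?_, ?_⟩
      · grind [Finset.mem_symmDiff]
      · intro t ht
        have := @h2 t
        grind [Finset.mem_symmDiff]

/-- A geodesic from `u` to `v` has a vertex at each distance `m` from `u`. -/
lemma IsometricFamily.exists_mem_card_eq (hS : IsometricFamily S) (hu : u ∈ S) (hv : v ∈ S) :
    m ≤ #(u ∆ v) → ∃ z ∈ S, u ∆ z ⊆ u ∆ v ∧ #(u ∆ z) = m := by
  induction m with
  | zero => intro _; exact ⟨u, hu, by simp, by simp⟩
  | succ m ih =>
    intro h
    obtain ⟨z, hz, hsub, hcard⟩ := ih (by omega)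
    obtain ⟨i, hi, hzi⟩ := hS z hz v hv (by rintro rfl; omega)
    have hi' : i ∉ u ∆ z := by
      intro h'
      have := hsub h'
      grind [Finset.mem_symmDiff]
    refine ⟨z ∆ {i}, hzi, ?_, ?_⟩
    · rw [symmDiff_symmDiff_singleton_of_notMem hi']
      refine Finset.insert_subset ?_ hsub
      grind [Finset.mem_symmDiff]
    · rw [symmDiff_symmDiff_singleton_of_notMem hi', Finset.card_insert_of_notMem hi', hcard]

/-- From an edge of direction `i`, the nearest edge of the same direction in an interval is
consecutive to it. -/
lemma exists_consecutiveEdges (ha : a ∈ S) (hai : a ∆ {i} ∈ S) (hc : c ∈ S) (hci : c ∆ {i} ∈ S)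
    (hne : a ≠ c) (hi : i ∉ a ∆ c) :
    ∃ z, ConsecutiveEdges S i a z ∧ a ∆ z ⊆ a ∆ c := by
  obtain ⟨z, ⟨hz, hzi, hza, hzc⟩, hmin⟩ := (measure fun z : Finset ι => #(a ∆ z)).wf.has_min
    {z | z ∈ S ∧ z ∆ {i} ∈ S ∧ a ≠ z ∧ a ∆ z ⊆ a ∆ c} ⟨c, hc, hci, hne, subset_rfl⟩
  refine ⟨z, ⟨ha, hai, hz, hzi, hza, fun h => hi (hzc h), fun y hy hyi hyz => ?_⟩, hzc⟩
  by_cases hya : y = a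
  · exact Or.inl hya
  · right
    have h1 := hmin y ⟨hy, hyi, Ne.symm hya, hyz.trans hzc⟩
    have h2 := Finset.eq_of_subset_of_card_le hyz (not_lt.1 h1)
    exact symmDiff_right_injective a h2

/-- If `a` has two different neighbours nearer to `w`, then each of the two edges has a
consecutive edge in the interval from `a` to `w`. -/
lemma IsometricFamily.exists_consecutiveEdges_of_two (hS : IsometricFamily S) (ha : a ∈ S)
    (hw : w ∈ S) (hai : a ∆ {i} ∈ S) (has : a ∆ {s} ∈ S) (hi : i ∈ a ∆ w) (hs : s ∈ a ∆ w)
    (his : s ≠ i) : ∃ c, ConsecutiveEdges S i a c ∧ a ∆ c ⊆ a ∆ w := by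
  have he := symmDiff_singleton_symmDiff_of_mem hs
  obtain ⟨z, hz, hzi, h1, h2⟩ := hS.exists_edge_of_mem_symmDiff (i := i) has hw
    (by rw [he]; exact Finset.mem_erase.2 ⟨Ne.symm his, hi⟩)
  rw [he] at h2
  have h3 : a ∆ z ⊆ a ∆ w := by
    intro t ht
    have := @h2 t
    grind [Finset.mem_symmDiff]
  have h4 : a ≠ z := by
    rintro rfl
    have := @h2 s
    grind [Finset.mem_symmDiff]
  obtain ⟨c, hc, hcz⟩ := exists_consecutiveEdges ha hai hz hzi h4 (by grind [Finset.mem_symmDiff])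
  exact ⟨c, hc, hcz.trans h3⟩

lemma HasGap.le_card_symmDiff (hk : HasGap S k) (ha : a ∈ S) (hai : a ∆ {i} ∈ S) (hc : c ∈ S)
    (hci : c ∆ {i} ∈ S) (hne : a ≠ c) (hi : i ∉ a ∆ c) : k ≤ #(a ∆ c) := by
  obtain ⟨z, hz, hsub⟩ := exists_consecutiveEdges ha hai hc hci hne hi
  rw [← hk i a z hz]
  exact Finset.card_le_card hsub

/-- At most one neighbour of `x` is nearer to a vertex at distance at most `k`: a second one would
produce two edges of equal direction at distance less than `k`. -/
lemma HasGap.eq_of_mem_symmDiff (hS : IsometricFamily S) (hk : HasGap S k) (hx : x ∈ S)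
    (hw : w ∈ S) (hxw : #(x ∆ w) ≤ k) (hi : i ∈ x ∆ w) (hs : s ∈ x ∆ w) (hxi : x ∆ {i} ∈ S)
    (hxs : x ∆ {s} ∈ S) : s = i := by
  by_contra hne
  obtain ⟨c, hc, hsub⟩ := hS.exists_consecutiveEdges_of_two hx hw hxi hxs hi hs hne
  have h1 := hk i x c hc
  have h2 : x ∆ c ⊂ x ∆ w := Finset.ssubset_iff_subset_ne.2
    ⟨hsub, fun h => hc.same_side (h ▸ hi)⟩
  have := Finset.card_lt_card h2
  omega

/-- If `x ∆ {i}` is the only neighbour of `x` towards `w`, then a chain at `x ∆ {i}` extends to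
`x`. -/
lemma IsChainUpTo.step (hS : IsometricFamily S) (hx : x ∈ S)
    (hi : i ∈ x ∆ w) (huniq : ∀ s ∈ x ∆ w, x ∆ {s} ∈ S → s = i)
    (h : IsChainUpTo S (x ∆ {i}) w m) : IsChainUpTo S x w (m + 1) := by
  have key : ∀ u ∈ S, x ∆ u ⊆ x ∆ w → x ≠ u → i ∈ x ∆ u := by
    intro u hu hsub hne
    obtain ⟨s, hs, hxs⟩ := hS x hx u hu hne
    rwa [huniq s (hsub hs) hxs] at hs
  intro u hu u' hu' hsub hsub' hcard hle
  by_cases hxu : x = u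
  · subst hxu
    simpa using hcard.symm
  have hxu' : x ≠ u' := by
    rintro rfl
    simp at hcard
    exact hxu hcard
  have h1 := key u hu hsub hxu
  have h2 := key u' hu' hsub' hxu'
  apply h u hu u' hu'
  · rw [symmDiff_singleton_symmDiff_of_mem h1, symmDiff_singleton_symmDiff_of_mem hi]
    exact Finset.erase_subset_erase _ hsub
  · rw [symmDiff_singleton_symmDiff_of_mem h2, symmDiff_singleton_symmDiff_of_mem hi]
    exact Finset.erase_subset_erase _ hsub'
  · rw [symmDiff_singleton_symmDiff_of_mem h1, symmDiff_singleton_symmDiff_of_mem h2,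
      Finset.card_erase_of_mem h1, Finset.card_erase_of_mem h2, hcard]
  · rw [symmDiff_singleton_symmDiff_of_mem h1, Finset.card_erase_of_mem h1]
    omega

lemma IsChainUpTo.mono (h : IsChainUpTo S x w m) {n : ℕ} (hn : n ≤ m) : IsChainUpTo S x w n :=
  fun u hu u' hu' h1 h2 h3 h4 => h u hu u' hu' h1 h2 h3 (h4.trans hn)

/-- Geodesics of length at most `k` are unique. -/
lemma HasGap.isChainUpTo (hS : IsometricFamily S) (hk : HasGap S k) (hw : w ∈ S) :
    ∀ n, ∀ x ∈ S, #(x ∆ w) = n → n ≤ k → ∀ m, IsChainUpTo S x w m := by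
  intro n
  induction n with
  | zero =>
    intro x hx h0 _ m u hu u' hu' h1 h2 _ _
    rw [Finset.card_eq_zero] at h0
    rw [h0, Finset.subset_empty] at h1 h2
    exact symmDiff_right_injective x (h1.trans h2.symm)
  | succ n ih =>
    intro x hx hn hnk m
    obtain ⟨i, hi, hxi⟩ := hS x hx w hw (by rintro rfl; simp at hn)
    refine IsChainUpTo.mono (IsChainUpTo.step hS hx hi ?_ (ih _ hxi ?_ (by omega) m)) (Nat.le_succ m)
    · intro s hs hxs
      exact hk.eq_of_mem_symmDiff hS hx hw (by omega) hi hs hxi hxs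
    · rw [symmDiff_singleton_symmDiff_of_mem hi, Finset.card_erase_of_mem hi, hn]; rfl

end Family

/-! ### Regular families -/

/-- Every member of `S` has exactly `d` neighbours in `S`. -/
def IsRegularFamily {ι : Type*} [DecidableEq ι] (S : Set (Finset ι)) (d : ℕ) : Prop :=
  ∀ u ∈ S, {i | u ∆ {i} ∈ S}.ncard = d

section Main

variable {ι : Type*} [DecidableEq ι] [Finite ι] {S : Set (Finset ι)} {k d : ℕ}
  {u v w x a c : Finset ι} {i j s : ι}

/-- Consider the vertices from which the interval to `w` starts as a path of length `k`, and let `x`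
be a farthest one from `w`. Every direction at `x` leading away from `w` closes up a convex cycle
through that path, so it is also a direction at the end `u` of the path. Together with the last edge
of the path these are `d` directions at `u` leading away from `w`; hence `u` has no neighbour nearer
to `w`, that is, `u = w`. -/
lemma opposite_of_farthest (hS : IsometricFamily S) (hk : HasGap S k) (hk1 : 1 ≤ k)
    (hd : IsRegularFamily S d) (hw : w ∈ S) (hx : x ∈ S) (hkx : k ≤ #(x ∆ w))
    (hch : IsChainUpTo S x w k)
    (hmax : ∀ y ∈ S, k ≤ #(y ∆ w) → IsChainUpTo S y w k → #(y ∆ w) ≤ #(x ∆ w)) :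
    #(x ∆ w) = k ∧ ∀ i, x ∆ {i} ∈ S → i ∉ x ∆ w → w ∆ {i} ∈ S := by
  obtain ⟨u, hu, hux, hcu⟩ := hS.exists_mem_card_eq hx hw hkx
  have hup : ∀ i, x ∆ {i} ∈ S → i ∉ x ∆ w → u ∆ {i} ∈ S := by
    intro i hxi hi
    have he := symmDiff_singleton_symmDiff_of_notMem hi
    have hxx : x ∆ {i} ∆ {i} = x := by simp
    have hcard : #((x ∆ {i}) ∆ w) = #(x ∆ w) + 1 := by
      rw [he, Finset.card_insert_of_notMem hi]
    -- since `x` is farthest, its neighbour `x ∆ {i}` has a second neighbour towards `w`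
    obtain ⟨s, hs, hxs, hsi⟩ : ∃ s ∈ (x ∆ {i}) ∆ w, (x ∆ {i}) ∆ {s} ∈ S ∧ s ≠ i := by
      by_contra! hcon
      have h1 : IsChainUpTo S (x ∆ {i}) w (k + 1) :=
        IsChainUpTo.step hS hxi (by rw [he]; exact Finset.mem_insert_self _ _) hcon
          (by rwa [hxx])
      have h2 := hmax _ hxi (by omega) (h1.mono (Nat.le_succ k))
      omega
    obtain ⟨c, hc, hsub⟩ := hS.exists_consecutiveEdges_of_two (i := i) hxi hw (by rwa [hxx]) hxs
      (by rw [he]; exact Finset.mem_insert_self _ _) hs hsi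
    have hcd := hk _ _ _ hc
    have hcx : x ∆ (c ∆ {i}) = (x ∆ {i}) ∆ c := by
      rw [symmDiff_assoc, symmDiff_comm c]
    have hcu' : c ∆ {i} = u := by
      refine hch _ hc.right_flip_mem u hu ?_ hux (by rw [hcx, hcd, hcu]) (by rw [hcx, hcd])
      rw [hcx]
      intro t ht
      have h3 := hsub ht
      rw [he, Finset.mem_insert] at h3
      rcases h3 with rfl | h3
      · exact absurd ht hc.same_side
      · exact h3
    rw [← hcu']
    simpa [symmDiff_assoc] using hc.right_mem
  obtain ⟨j, hj, hxj⟩ := hS x hx w hw (by rintro rfl; simp at hkx; omega)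
  have hjuniq : ∀ s ∈ x ∆ w, x ∆ {s} ∈ S → s = j := by
    intro s hs hxs
    have := hch _ hxs _ hxj (by simpa using hs) (by simpa using hj)
      (by simp) (by simpa using hk1)
    simpa using this
  by_cases huw : u = w
  · subst huw
    exact ⟨hcu, hup⟩
  -- otherwise `u` has too many directions: those of `x` except `j`, the direction `r` back to `x`,
  -- and a direction `q` towards `w`
  · exfalso
    obtain ⟨r, hr, hur⟩ := hS u hu x hx (by rintro rfl; simp at hcu; omega)
    obtain ⟨q, hq, huq⟩ := hS u hu w hw huw
    have hr' := @hux r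
    have hq' := @hux q
    have hsub : insert q (insert r ({i | x ∆ {i} ∈ S} \ {j})) ⊆ {i | u ∆ {i} ∈ S} := by
      intro i hi
      rcases hi with rfl | rfl | ⟨hi, hij⟩
      · exact huq
      · exact hur
      · exact hup i hi fun h => hij (hjuniq i h hi)
    have h1 := Set.ncard_le_ncard hsub (Set.toFinite _)
    have h2 : ({i | x ∆ {i} ∈ S} \ {j}).ncard + 1 = d := by
      rw [← hd x hx]
      exact Set.ncard_sdiff_singleton_add_one hxj
    have hrw : r ∈ x ∆ w := by grind [Finset.mem_symmDiff]
    have hqw : q ∈ x ∆ w := by grind [Finset.mem_symmDiff]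
    have hrq : q ≠ r := by rintro rfl; grind [Finset.mem_symmDiff]
    have hno : ∀ s ∈ x ∆ w, s ∉ {i | x ∆ {i} ∈ S} \ {j} := fun s hs hs' =>
      hs'.2 (hjuniq s hs hs'.1)
    rw [hd u hu, Set.ncard_insert_of_notMem _ (Set.toFinite _),
      Set.ncard_insert_of_notMem (hno r hrw) (Set.toFinite _)] at h1
    · omega
    · rintro (h | h)
      · exact hrq h
      · exact hno q hqw h

/-- At distance `k`, the directions at `x` leading away from `w` are directions at `w`: every
path with `k + 1` edges lies in a convex cycle. -/
theorem opposite_flip_mem (hS : IsometricFamily S) (hk : HasGap S k) (hk1 : 1 ≤ k)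
    (hd : IsRegularFamily S d) (hw : w ∈ S) (hx : x ∈ S) (hkx : #(x ∆ w) = k)
    (hxi : x ∆ {i} ∈ S) (hi : i ∉ x ∆ w) : w ∆ {i} ∈ S := by
  have hchain : ∀ y ∈ S, #(y ∆ w) = k → IsChainUpTo S y w k := fun y hy h =>
    hk.isChainUpTo hS hw k y hy h le_rfl k
  obtain ⟨y, ⟨hy, hky, hcy⟩, hmax⟩ := Set.exists_max_image
    {y | y ∈ S ∧ k ≤ #(y ∆ w) ∧ IsChainUpTo S y w k} (fun y => #(y ∆ w)) (Set.toFinite _)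
    ⟨x, hx, hkx.ge, hchain x hx hkx⟩
  have hyk := (opposite_of_farthest hS hk hk1 hd hw hy hky hcy
    fun z hz h1 h2 => hmax z ⟨hz, h1, h2⟩).1
  refine (opposite_of_farthest hS hk hk1 hd hw hx hkx.ge (hchain x hx hkx) ?_).2 i hxi hi
  intro z hz h1 h2
  rw [hkx, ← hyk]
  exact hmax z ⟨hz, h1, h2⟩

/-- A regular family with gap at least `3` has degree at most `2`: if a path of length `k` could be
prolonged in two directions `i` and `l`, both prolongations would lie in convex cycles, and the edges
opposite to the first edge of the path in these cycles would be at distance two. -/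
theorem degree_le_two_of_three_le_gap (hS : IsometricFamily S) (hk : HasGap S k) (hk3 : 3 ≤ k)
    (hd : IsRegularFamily S d) (hx : x ∈ S) (hw : w ∈ S) (hxw : #(x ∆ w) = k) : d ≤ 2 := by
  by_contra! hd3
  obtain ⟨j, hj, hxj⟩ := hS x hx w hw (by rintro rfl; simp at hxw; omega)
  obtain ⟨c, hc, hwc⟩ := hS w hw x hx (by rintro rfl; simp at hxw; omega)
  rw [symmDiff_comm] at hc
  have hjuniq : ∀ s ∈ x ∆ w, x ∆ {s} ∈ S → s = j := fun s hs hxs =>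
    hk.eq_of_mem_symmDiff hS hx hw hxw.le hj hs hxj hxs
  obtain ⟨i, ⟨hi, hij⟩, l, ⟨hl, hlj⟩, hil⟩ :
      ∃ i ∈ {i | x ∆ {i} ∈ S} \ {j}, ∃ l ∈ {i | x ∆ {i} ∈ S} \ {j}, i ≠ l := by
    rw [← Set.one_lt_ncard]
    have h2 : ({i | x ∆ {i} ∈ S} \ {j}).ncard + 1 = d := by
      rw [← hd x hx]
      exact Set.ncard_sdiff_singleton_add_one hxj
    omega
  have key : ∀ i, x ∆ {i} ∈ S → i ≠ j → i ∉ x ∆ w ∧ (x ∆ {i}) ∆ {c} ∈ S := by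
    intro i hi hij
    have hixw : i ∉ x ∆ w := fun h => hij (hjuniq i h hi)
    refine ⟨hixw, ?_⟩
    have he : (w ∆ {c}) ∆ (x ∆ {i}) = insert i ((x ∆ w).erase c) := by
      ext t; grind [Finset.mem_symmDiff]
    refine opposite_flip_mem hS hk (by omega) hd hi hwc ?_ (i := c) ?_ ?_
    · rw [he, Finset.card_insert_of_notMem (by simp [hixw]), Finset.card_erase_of_mem hc]
      omega
    · simpa [symmDiff_assoc] using hw
    · rw [he]
      simp only [Finset.mem_insert, Finset.mem_erase, ne_eq, not_true_eq_false, false_and, or_false]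
      rintro rfl
      exact hixw hc
  obtain ⟨hi1, hi2⟩ := key i hi hij
  obtain ⟨hl1, hl2⟩ := key l hl hlj
  have he : (x ∆ {i}) ∆ (x ∆ {l}) = {i, l} := by
    ext t; grind [Finset.mem_symmDiff]
  have hle := hk.le_card_symmDiff hi hi2 hl hl2 (by
    intro h
    have : i ∈ (x ∆ {i}) ∆ (x ∆ {l}) := by rw [he]; simp
    simp [h] at this) (by
    rw [he]; simp only [Finset.mem_insert, Finset.mem_singleton]
    rintro (rfl | rfl)
    · exact hi1 hc
    · exact hl1 hc)
  rw [he, Finset.card_pair hil] at hle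
  omega

/-- In a regular family with gap `1`, all members have the same directions. -/
theorem flip_mem_of_gap_one (hS : IsometricFamily S) (hk : HasGap S 1)
    (hd : IsRegularFamily S d) : ∀ n, ∀ u ∈ S, ∀ v ∈ S, #(u ∆ v) = n → u ∆ {i} ∈ S → v ∆ {i} ∈ S := by
  intro n
  induction n with
  | zero =>
    intro u hu v hv h hi
    rw [Finset.card_eq_zero] at h
    rwa [← symmDiff_eq_bot.1 h]
  | succ n ih =>
    intro u hu v hv h hi
    obtain ⟨j, hj, huj⟩ := hS u hu v hv (by rintro rfl; simp at h)
    refine ih (u ∆ {j}) huj v hv ?_ ?_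
    · rw [symmDiff_singleton_symmDiff_of_mem hj, Finset.card_erase_of_mem hj, h]; rfl
    · by_cases hij : i = j
      · subst hij
        simpa [symmDiff_assoc] using hu
      · exact opposite_flip_mem hS hk le_rfl hd huj hu (by simp) hi (by simpa using hij)

/-- In a regular family with gap `2`, the neighbours of a given member all have the same
directions, up to the one leading back. -/
theorem flip_mem_of_gap_two (hS : IsometricFamily S) (hk : HasGap S 2) (hd : IsRegularFamily S d)
    {y : Finset ι} {l : ι} (hy : y ∈ S) (hj : y ∆ {j} ∈ S) (hl : y ∆ {l} ∈ S)
    (hi : (y ∆ {j}) ∆ {i} ∈ S) (hij : i ≠ j) : (y ∆ {l}) ∆ {i} ∈ S := by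
  by_cases hjl : j = l
  · subst hjl; exact hi
  have he : (y ∆ {j}) ∆ (y ∆ {l}) = {j, l} := by
    ext t; grind [Finset.mem_symmDiff]
  have hc : #((y ∆ {j}) ∆ (y ∆ {l})) = 2 := by rw [he, Finset.card_pair hjl]
  refine opposite_flip_mem hS hk one_le_two hd hl hj hc hi ?_
  intro h
  exact hij (hk.eq_of_mem_symmDiff hS hj hl hc.le (by rw [he]; simp) h
    (by simpa using hy) hi)

end Main

/-! ### The subcube spanned by two consecutive edges -/

section Consecutive

variable {ι : Type*} [DecidableEq ι] {S : Set (Finset ι)} {a c x y : Finset ι} {i : ι}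

lemma symmDiff_flip_flip : (a ∆ {i}) ∆ (c ∆ {i}) = a ∆ c := by
  ext t; grind [Finset.mem_symmDiff]

lemma ConsecutiveEdges.flip (h : ConsecutiveEdges S i a c) :
    ConsecutiveEdges S i (a ∆ {i}) (c ∆ {i}) where
  left_mem := h.left_flip_mem
  left_flip_mem := by simpa using h.left_mem
  right_mem := h.right_flip_mem
  right_flip_mem := by simpa using h.right_mem
  ne := fun he => h.ne (symmDiff_left_injective _ he)
  same_side := by rw [symmDiff_flip_flip]; exact h.same_side
  between := by
    intro z hz hzi hsub
    have h1 : a ∆ (z ∆ {i}) = (a ∆ {i}) ∆ z := by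
      rw [symmDiff_assoc, symmDiff_comm z]
    have := h.between (z ∆ {i}) hzi (by simpa using hz) (by
      rw [h1]; rw [symmDiff_flip_flip] at hsub; exact hsub)
    rcases this with h | h
    · left; rw [← h]; simp
    · right; rw [← h]; simp

/-- In the subcube spanned by two consecutive edges, vertices on the two sides at complementary
distances from the first edge have complementary positions. -/
lemma ConsecutiveEdges.symmDiff_eq_sdiff (hS : IsometricFamily S) (h : ConsecutiveEdges S i a c)
    (hx : x ∈ S) (hy : y ∈ S) (hxa : a ∆ x ⊆ a ∆ c) (hya : (a ∆ {i}) ∆ y ⊆ a ∆ c)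
    (hcard : #(a ∆ x) + #((a ∆ {i}) ∆ y) = #(a ∆ c)) :
    a ∆ x = (a ∆ c) \ ((a ∆ {i}) ∆ y) := by
  have hi := h.same_side
  have hix : i ∉ a ∆ x := fun h => hi (hxa h)
  have hiy : i ∉ (a ∆ {i}) ∆ y := fun h => hi (hya h)
  have hxy : i ∈ x ∆ y := by grind [Finset.mem_symmDiff]
  obtain ⟨z, hz, hzi, hiz, hzs⟩ := hS.exists_edge_of_mem_symmDiff hx hy hxy
  have hza : a ∆ z ⊆ a ∆ c := by
    intro t ht
    have h1 := @hzs t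
    have h2 := @hxa t
    have h3 := @hya t
    grind [Finset.mem_symmDiff]
  -- the edge of direction `i` on a geodesic from `x` to `y` is one of the two given ones
  rcases h.between z hz hzi hza with rfl | rfl
  · have hdisj : Disjoint (z ∆ x) ((z ∆ {i}) ∆ y) := by
      rw [Finset.disjoint_left]
      intro t ht ht'
      have h1 := @hzs t
      have h2 : t ≠ i := by rintro rfl; exact hix ht
      grind [Finset.mem_symmDiff]
    have hun := Finset.eq_of_subset_of_card_le (Finset.union_subset hxa hya)
      (by rw [Finset.card_union_of_disjoint hdisj, hcard])
    rw [← hun, Finset.union_sdiff_cancel_right hdisj]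
  · have hun : (a ∆ x) ∪ ((a ∆ {i}) ∆ y) = a ∆ z := by
      refine (Finset.union_subset hxa hya).antisymm fun t ht => ?_
      have h1 := @hzs t
      have h2 : t ≠ i := by rintro rfl; exact hi ht
      grind [Finset.mem_symmDiff]
    have hdisj : Disjoint (a ∆ x) ((a ∆ {i}) ∆ y) := by
      rw [← Finset.card_union_eq_card_add_card, hun, hcard]
    rw [← hun, Finset.union_sdiff_cancel_right hdisj]

/-- The position of a vertex between the near ends of two consecutive edges is the complement of
the position of any vertex at the complementary distance on the other side, so it depends only on
its distance. -/
lemma ConsecutiveEdges.isChainUpTo (hS : IsometricFamily S) (h : ConsecutiveEdges S i a c) :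
    IsChainUpTo S a c #(a ∆ c) := by
  intro u hu u' hu' h1 h2 h3 h4
  -- a vertex on the other side, at the complementary distance from the first edge
  obtain ⟨y, hy, hya, hyc⟩ := hS.exists_mem_card_eq h.left_flip_mem h.right_flip_mem
    (m := #(a ∆ c) - #(a ∆ u)) (by rw [symmDiff_flip_flip]; omega)
  rw [symmDiff_flip_flip] at hya
  have e1 := h.symmDiff_eq_sdiff hS hu hy h1 hya (by omega)
  have e2 := h.symmDiff_eq_sdiff hS hu' hy h2 hya (by omega)
  exact symmDiff_right_injective a (e1.trans e2.symm)

end Consecutive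

/-! ### Graphs coded by finite sets, and convex cycles -/

/-- A coding of the vertices of a graph by finite sets such that the graph distance is the
number of coordinates in which the codes differ. -/
structure IsCubeCoding {V ι : Type*} [DecidableEq ι] (G : SimpleGraph V) (f : V → Finset ι) :
    Prop where
  connected : G.Connected
  dist_eq : ∀ u v, G.dist u v = #(f u ∆ f v)

section Coding

open SimpleGraph

variable {V ι : Type*} [DecidableEq ι] {G : SimpleGraph V} {f : V → Finset ι} {u v w z : V} {i : ι}

lemma IsCubeCoding.injective (hf : IsCubeCoding G f) : Function.Injective f := by
  intro u v h
  have := hf.dist_eq u v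
  rw [h, symmDiff_self, Finset.bot_eq_empty, Finset.card_empty] at this
  exact (hf.connected.dist_eq_zero_iff).1 this

lemma IsCubeCoding.adj_iff_card (hf : IsCubeCoding G f) : G.Adj u v ↔ #(f u ∆ f v) = 1 := by
  rw [← hf.dist_eq, dist_eq_one_iff_adj]

lemma IsCubeCoding.adj_iff (hf : IsCubeCoding G f) : G.Adj u v ↔ ∃ i, f v = f u ∆ {i} := by
  rw [hf.adj_iff_card, Finset.card_eq_one]
  refine exists_congr fun i => ?_
  constructor
  · intro h; rw [← h]; simp
  · intro h; rw [h]; simp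

lemma IsCubeCoding.isometricFamily (hf : IsCubeCoding G f) : IsometricFamily (Set.range f) := by
  rintro _ ⟨u, rfl⟩ _ ⟨v, rfl⟩ hne
  obtain ⟨p, hp⟩ := hf.connected.exists_walk_length_eq_dist u v
  cases p with
  | nil => exact absurd rfl hne
  | @cons _ w _ h q =>
    obtain ⟨i, hi⟩ := hf.adj_iff.1 h
    refine ⟨i, ?_, w, hi⟩
    by_contra hni
    have h1 := hf.dist_eq u v
    have h2 := hf.dist_eq w v
    have h3 := dist_le q
    rw [hi, symmDiff_singleton_symmDiff_of_notMem hni, Finset.card_insert_of_notMem hni] at h2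
    rw [Walk.length_cons] at hp
    omega

lemma IsCubeCoding.card_getVert (hf : IsCubeCoding G f) {p : G.Walk u v}
    (hp : p.length = G.dist u v) {s : ℕ} (hs : s ≤ p.length) :
    #(f u ∆ f (p.getVert s)) = s ∧ f u ∆ f (p.getVert s) ⊆ f u ∆ f v := by
  have h1 := dist_le (p.take s)
  have h2 := dist_le (p.drop s)
  rw [Walk.take_length] at h1
  rw [Walk.drop_length] at h2
  rw [hf.dist_eq] at h1 h2 hp
  set z := p.getVert s
  have hle : #(f u ∆ f v) ≤ #((f u ∆ f z) ∪ (f z ∆ f v)) := by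
    refine Finset.card_le_card fun t ht => ?_
    grind [Finset.mem_symmDiff]
  have hun := Finset.card_union_add_card_inter (f u ∆ f z) (f z ∆ f v)
  have hin : (f u ∆ f z) ∩ (f z ∆ f v) = ∅ := by
    rw [← Finset.card_eq_zero]; omega
  refine ⟨by omega, fun t ht => ?_⟩
  have : t ∉ (f u ∆ f z) ∩ (f z ∆ f v) := by rw [hin]; simp
  grind [Finset.mem_symmDiff]

/-- Vertices of a geodesic lie in the interval of the cube between its ends. -/
lemma IsCubeCoding.subset_of_mem_support (hf : IsCubeCoding G f) {p : G.Walk u v}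
    (hp : p.length = G.dist u v) (hz : z ∈ p.support) : f u ∆ f z ⊆ f u ∆ f v := by
  obtain ⟨s, rfl, hs⟩ := Walk.mem_support_iff_exists_getVert.1 hz
  exact (hf.card_getVert hp hs).2

/-- When the interval from `u` to `v` is a chain, it consists of the vertices of any one geodesic. -/
lemma IsCubeCoding.eq_getVert (hf : IsCubeCoding G f) {p : G.Walk u v}
    (hp : p.length = G.dist u v)
    (hch : IsChainUpTo (Set.range f) (f u) (f v) #(f u ∆ f v)) (hz : f u ∆ f z ⊆ f u ∆ f v) :
    z = p.getVert #(f u ∆ f z) := by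
  have hle := Finset.card_le_card hz
  obtain ⟨h1, h2⟩ := hf.card_getVert hp (s := #(f u ∆ f z)) (by rw [hp, hf.dist_eq]; exact hle)
  exact hf.injective (hch _ ⟨_, rfl⟩ _ ⟨_, rfl⟩ hz h2 h1.symm hle)

lemma IsCubeCoding.mem_support (hf : IsCubeCoding G f) {p : G.Walk u v}
    (hp : p.length = G.dist u v)
    (hch : IsChainUpTo (Set.range f) (f u) (f v) #(f u ∆ f v)) (hz : f u ∆ f z ⊆ f u ∆ f v) :
    z ∈ p.support := by
  rw [hf.eq_getVert hp hch hz]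
  exact p.getVert_mem_support _

lemma IsCubeCoding.toSubgraph_adj (hf : IsCubeCoding G f) {p : G.Walk u v}
    (hp : p.length = G.dist u v)
    (hch : IsChainUpTo (Set.range f) (f u) (f v) #(f u ∆ f v)) (hw : f u ∆ f w ⊆ f u ∆ f v)
    (hz : f u ∆ f z ⊆ f u ∆ f v) (hwz : G.Adj w z) : p.toSubgraph.Adj w z := by
  wlog h : #(f u ∆ f w) ≤ #(f u ∆ f z) generalizing w z
  · exact (this hz hw hwz.symm (by omega)).symm
  have e1 := hf.eq_getVert hp hch hw
  have e2 := hf.eq_getVert hp hch hz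
  obtain ⟨i, hi⟩ := hf.adj_iff.1 hwz
  have hle := Finset.card_le_card hz
  by_cases hiw : i ∈ f u ∆ f w
  · exfalso
    rw [symmDiff_comm] at hiw
    have h3 := symmDiff_singleton_symmDiff_of_mem hiw
    rw [← hi] at h3
    rw [symmDiff_comm (f u), symmDiff_comm (f u), h3, Finset.card_erase_of_mem hiw] at h
    have := Finset.card_pos.2 ⟨i, hiw⟩
    omega
  · have h4 : #(f u ∆ f z) = #(f u ∆ f w) + 1 := by
      rw [hi, symmDiff_symmDiff_singleton_of_notMem hiw, Finset.card_insert_of_notMem hiw]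
    rw [e1, e2, h4]
    exact p.toSubgraph_adj_getVert (by rw [hp, hf.dist_eq]; omega)

lemma SimpleGraph.Walk.length_mapToSubgraph {V : Type*} {G : SimpleGraph V} {u v : V}
    (p : G.Walk u v) : p.mapToSubgraph.length = p.length := by
  have := congrArg Walk.length p.map_mapToSubgraph_hom
  rwa [Walk.length_map] at this

/-- In a connected graph, closure under geodesics already implies being isometric. -/
lemma SimpleGraph.Subgraph.isConvex_of_geodesics_le {V : Type*} {G : SimpleGraph V}
    (hG : G.Connected) {H : G.Subgraph}
    (h : ∀ u ∈ H.verts, ∀ v ∈ H.verts, ∀ p : G.Walk u v, p.length = G.dist u v →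
      p.toSubgraph ≤ H) : H.IsConvex := by
  refine ⟨fun u v => le_antisymm ?_ ?_, h⟩
  · obtain ⟨p, hp⟩ := hG.exists_walk_length_eq_dist (u : V) v
    have hle := h u u.2 v v.2 p hp
    have h1 := edist_le (p.mapToSubgraph.map (Subgraph.inclusion hle))
    have h2 : (p.mapToSubgraph.map (Subgraph.inclusion hle)).length = p.length := by
      rw [Walk.length_map, Walk.length_mapToSubgraph]
    rw [h2, hp, (hG u v).coe_dist_eq_edist] at h1
    exact h1
  · by_cases htop : H.coe.edist u v = ⊤
    · rw [htop]; exact le_top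
    · obtain ⟨p, hp⟩ := exists_walk_of_edist_ne_top htop
      rw [← hp, ← Walk.length_map H.hom]
      exact edist_le _

/-- Two consecutive edges of equal direction span a convex cycle, which consists of all
vertices in the subcube they span. -/
theorem IsCubeCoding.exists_convex_cycle (hf : IsCubeCoding G f) {a c : V}
    (h : ConsecutiveEdges (Set.range f) i (f a) (f c)) :
    ∃ (v : V) (p : G.Walk v v), p.IsCycle ∧ p.toSubgraph.IsConvex ∧
      p.length = 2 * (#(f a ∆ f c) + 1) := by
  have hS := hf.isometricFamily
  obtain ⟨a', ha'⟩ := h.left_flip_mem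
  obtain ⟨c', hc'⟩ := h.right_flip_mem
  have hch := h.isChainUpTo hS
  have hch' := h.flip.isChainUpTo hS
  rw [← ha', ← hc'] at hch'
  have hD : f a' ∆ f c' = f a ∆ f c := by rw [ha', hc', symmDiff_flip_flip]
  have haa : G.Adj a' a := (hf.adj_iff.2 ⟨i, ha'⟩).symm
  have hcc : G.Adj c c' := hf.adj_iff.2 ⟨i, hc'⟩
  obtain ⟨p, hp⟩ := hf.connected.exists_walk_length_eq_dist a c
  obtain ⟨q, hq⟩ := hf.connected.exists_walk_length_eq_dist a' c'
  have hi := h.same_side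
  have hpl : p.length = #(f a ∆ f c) := by rw [hp, hf.dist_eq]
  have hql : q.length = #(f a ∆ f c) := by rw [hq, hf.dist_eq, hD]
  have hpos : 0 < #(f a ∆ f c) := by
    rw [Finset.card_pos, Finset.nonempty_iff_ne_empty, ne_eq, ← Finset.bot_eq_empty, symmDiff_eq_bot]
    exact h.ne
  have hps : ∀ z, z ∈ p.support → f a ∆ f z ⊆ f a ∆ f c := fun z => hf.subset_of_mem_support hp
  have hqs : ∀ z, z ∈ q.support → f a' ∆ f z ⊆ f a ∆ f c := fun z hz =>
    hD ▸ hf.subset_of_mem_support hq hz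
  have hdisj : ∀ z, z ∈ p.support → z ∉ q.support := by
    intro z hz hz'
    have h1 := @hps z hz i
    have h2 := @hqs z hz' i
    rw [ha'] at h2
    grind [Finset.mem_symmDiff]
  set P : G.Walk a' c := Walk.cons haa p with hP
  set Q : G.Walk c a' := Walk.cons hcc q.reverse with hQ
  have hPp : P.IsPath := by
    rw [hP, Walk.cons_isPath_iff]
    exact ⟨p.isPath_of_length_eq_dist hp, fun hz => hdisj a' hz q.start_mem_support⟩
  have hQp : Q.IsPath := by
    rw [hQ, Walk.cons_isPath_iff]
    refine ⟨(q.isPath_of_length_eq_dist hq).reverse, fun hz => hdisj c p.end_mem_support ?_⟩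
    simpa using hz
  refine ⟨a', P.append Q, hPp.isCycle_append hQp ?_ (by simp [hP]; omega), ?_, ?_⟩
  · intro z hz hz'
    simp only [hP, hQ, Walk.support_cons, List.tail_cons, Walk.support_reverse,
      List.mem_reverse] at hz hz'
    exact hdisj z hz hz'
  · have hPQ : (P.append Q).toSubgraph =
        (G.subgraphOfAdj haa ⊔ p.toSubgraph) ⊔ (G.subgraphOfAdj hcc ⊔ q.toSubgraph) := by
      rw [Walk.toSubgraph_append, hP, hQ, Walk.toSubgraph, Walk.toSubgraph, Walk.toSubgraph_reverse]
    -- the vertices of the cycle are all those in the subcube spanned by the two edges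
    have hmem : ∀ z, z ∈ (P.append Q).toSubgraph.verts ↔ f a ∆ f z ⊆ insert i (f a ∆ f c) := by
      intro z
      have h1 : z ∈ (P.append Q).toSubgraph.verts ↔ z ∈ p.support ∨ z ∈ q.support := by
        simp only [Walk.mem_verts_toSubgraph, Walk.mem_support_append_iff, hP, hQ,
          Walk.support_cons, List.mem_cons, Walk.support_reverse, List.mem_reverse]
        constructor
        · rintro ((rfl | h) | (rfl | h))
          exacts [Or.inr q.start_mem_support, Or.inl h, Or.inl p.end_mem_support, Or.inr h]
        · rintro (h | h)
          exacts [Or.inl (Or.inr h), Or.inr (Or.inr h)]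
      rw [h1]
      constructor
      · rintro (hz | hz)
        · exact (hps z hz).trans (Finset.subset_insert _ _)
        · intro t ht
          have h2 := @hqs z hz t
          rw [ha'] at h2
          grind [Finset.mem_symmDiff]
      · intro hz
        by_cases hiz : i ∈ f a ∆ f z
        · right
          refine hf.mem_support hq hch' ?_
          intro t ht
          have h2 := @hz t
          rw [hD]
          rw [ha'] at ht
          grind [Finset.mem_symmDiff]
        · left
          refine hf.mem_support hp hch fun t ht => ?_
          have h2 := @hz t ht
          grind
    -- the cycle is an induced subgraph
    have hadj : ∀ z y, f a ∆ f z ⊆ insert i (f a ∆ f c) → f a ∆ f y ⊆ insert i (f a ∆ f c) →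
        G.Adj z y → (P.append Q).toSubgraph.Adj z y := by
      intro z y hz hy hzy
      wlog hiz : i ∉ f a ∆ f z ∨ i ∈ f a ∆ f y generalizing z y
      · push Not at hiz
        exact (this y z hy hz hzy.symm (Or.inl hiz.2)).symm
      have hlow : ∀ z, f a ∆ f z ⊆ insert i (f a ∆ f c) → i ∉ f a ∆ f z →
          f a ∆ f z ⊆ f a ∆ f c := by
        intro z hz hiz t ht
        have h2 := @hz t ht
        grind
      have hhigh : ∀ z, f a ∆ f z ⊆ insert i (f a ∆ f c) → i ∈ f a ∆ f z →
          f a' ∆ f z ⊆ f a' ∆ f c' := by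
        intro z hz hiz t ht
        have h2 := @hz t
        rw [hD]
        rw [ha'] at ht
        grind [Finset.mem_symmDiff]
      rw [hPQ]
      by_cases hz1 : i ∈ f a ∆ f z
      · have hy1 : i ∈ f a ∆ f y := hiz.resolve_left (not_not.2 hz1)
        exact Or.inr (Or.inr (hf.toSubgraph_adj hq hch' (hhigh z hz hz1) (hhigh y hy hy1) hzy))
      · by_cases hy1 : i ∈ f a ∆ f y
        · obtain ⟨j, hj⟩ := hf.adj_iff.1 hzy
          have hji : j = i := by
            rw [hj] at hy1
            grind [Finset.mem_symmDiff]
          subst hji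
          rcases h.between (f z) ⟨z, rfl⟩ ⟨y, hj⟩ (hlow z hz hz1) with h1 | h1
          · have hza := hf.injective h1
            have hya : y = a' := hf.injective (by rw [hj, h1, ha'])
            subst hza hya
            refine Or.inl (Or.inl ?_)
            simp
          · have hza := hf.injective h1
            have hya : y = c' := hf.injective (by rw [hj, h1, hc'])
            subst hza hya
            refine Or.inr (Or.inl ?_)
            simp
        · exact Or.inl (Or.inr (hf.toSubgraph_adj hp hch (hlow z hz hz1) (hlow y hy hy1) hzy))
    refine Subgraph.isConvex_of_geodesics_le hf.connected fun u hu v hv g hg => ?_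
    have hgs : ∀ z ∈ g.support, f a ∆ f z ⊆ insert i (f a ∆ f c) := by
      intro z hz t ht
      have hz' := hf.subset_of_mem_support hg hz
      have hu' := (hmem u).1 hu
      have hv' := (hmem v).1 hv
      have h1 := @hz' t
      have h2 := @hu' t
      have h3 := @hv' t
      grind [Finset.mem_symmDiff]
    refine ⟨fun z hz => (hmem z).2 (hgs z ((Walk.mem_verts_toSubgraph g).1 hz)), fun z y hzy => ?_⟩
    exact hadj z y (hgs z (Walk.mem_support_of_adj_toSubgraph hzy))
      (hgs y (Walk.mem_support_of_adj_toSubgraph hzy.symm)) hzy.adj_sub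
  · simp only [hP, hQ, Walk.length_append, Walk.length_cons, Walk.length_reverse, hpl, hql]
    omega

end Coding

/-! ### Partial cubes, degrees and gaps -/

section PartialCube

open SimpleGraph

lemma hypercubeGraph_edist (n : ℕ) (x y : Fin n → Bool) :
    (hypercubeGraph n).edist x y = hammingDist x y := by
  apply le_antisymm
  · suffices ∀ m, ∀ x y : Fin n → Bool, hammingDist x y = m →
        ∃ p : (hypercubeGraph n).Walk x y, p.length = m by
      obtain ⟨p, hp⟩ := this _ x y rfl
      rw [← hp]
      exact edist_le p
    intro m
    induction m with
    | zero =>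
      intro x y h
      rw [hammingDist_eq_zero] at h
      subst h
      exact ⟨Walk.nil, rfl⟩
    | succ m ih =>
      intro x y h
      have hne : x ≠ y := by rintro rfl; simp at h
      obtain ⟨t, ht⟩ := Function.ne_iff.1 hne
      have h1 : ({s | x s ≠ Function.update x t (y t) s} : Finset (Fin n)) = {t} := by
        ext s
        by_cases hs : s = t <;> simp [hs, ht]
      have h2 : ({s | Function.update x t (y t) s ≠ y s} : Finset (Fin n)) =
          ({s | x s ≠ y s} : Finset (Fin n)).erase t := by
        ext s
        by_cases hs : s = t <;> simp [hs]
      have hadj : (hypercubeGraph n).Adj x (Function.update x t (y t)) := by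
        change hammingDist _ _ = 1
        rw [hammingDist, h1, Finset.card_singleton]
      obtain ⟨p, hp⟩ := ih (Function.update x t (y t)) y (by
        rw [hammingDist, h2, Finset.card_erase_of_mem (by simpa using ht)]
        change hammingDist x y - 1 = m
        omega)
      exact ⟨Walk.cons hadj p, by simp [hp]⟩
  · have key : ∀ {x y : Fin n → Bool} (p : (hypercubeGraph n).Walk x y),
        hammingDist x y ≤ p.length := by
      intro x y p
      induction p with
      | nil => simp
      | @cons u v w h p ih =>
        have h1 : hammingDist u v = 1 := h
        have := hammingDist_triangle u v w
        rw [Walk.length_cons]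
        omega
    by_cases htop : (hypercubeGraph n).edist x y = ⊤
    · rw [htop]; exact le_top
    · obtain ⟨p, hp⟩ := exists_walk_of_edist_ne_top htop
      rw [← hp]
      exact_mod_cast key p

variable {V : Type*} {G : SimpleGraph V}

/-- A vertex is coded by the set of coordinates equal to `1` in the hypercube. -/
lemma SimpleGraph.IsPartialCube.exists_isCubeCoding [Nonempty V] (hG : G.IsPartialCube) :
    ∃ (n : ℕ) (f : V → Finset (Fin n)), IsCubeCoding G f := by
  obtain ⟨n, H, hH, ⟨φ⟩⟩ := hG
  have hH' : ∀ u v : V, H.coe.edist (φ u) (φ v) = hammingDist (φ u).1 (φ v).1 := fun u v => by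
    rw [hH, hypercubeGraph_edist]
  have hwalk : ∀ u v : V, ∃ p : G.Walk u v, p.length = hammingDist (φ u).1 (φ v).1 := by
    intro u v
    obtain ⟨p, hp⟩ := exists_walk_of_edist_eq_coe (hH' u v)
    refine ⟨(p.map φ.symm.toHom).copy (by simp) (by simp), ?_⟩
    simpa using hp
  refine ⟨n, fun v => {i | (φ v).1 i = true}, ⟨fun u v => ⟨(hwalk u v).choose⟩⟩, fun u v => ?_⟩
  have hcard : #(({i | (φ u).1 i = true} : Finset (Fin n)) ∆
      ({i | (φ v).1 i = true} : Finset (Fin n))) =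
      hammingDist (φ u).1 (φ v).1 := by
    rw [hammingDist]
    congr 1
    ext i
    simp only [Finset.mem_symmDiff, Finset.mem_filter, Finset.mem_univ, true_and]
    cases (φ u).1 i <;> cases (φ v).1 i <;> simp
  rw [hcard]
  obtain ⟨p, hp⟩ := hwalk u v
  refine le_antisymm (hp ▸ dist_le p) ?_
  obtain ⟨q, hq⟩ := Reachable.exists_walk_length_eq_dist ⟨p⟩
  have h1 := edist_le (q.map φ.toHom)
  rw [Walk.length_map, hq] at h1
  have h2 := hH' u v
  change H.coe.edist (φ u) (φ v) ≤ _ at h1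
  rw [h2] at h1
  exact_mod_cast h1

variable {ι : Type*} [DecidableEq ι] {f : V → Finset ι} {d : ℕ}

lemma IsCubeCoding.isRegularFamily [Fintype V] [DecidableRel G.Adj] (hf : IsCubeCoding G f)
    (hd : G.IsRegularOfDegree d) : IsRegularFamily (Set.range f) d := by
  rintro _ ⟨u, rfl⟩
  have h1 : (fun i => f u ∆ {i}) '' {i | f u ∆ {i} ∈ Set.range f} = f '' G.neighborSet u := by
    ext z
    constructor
    · rintro ⟨i, ⟨v, hv⟩, rfl⟩
      exact ⟨v, hf.adj_iff.2 ⟨i, hv⟩, hv⟩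
    · rintro ⟨v, hv, rfl⟩
      obtain ⟨i, hi⟩ := hf.adj_iff.1 hv
      exact ⟨i, ⟨v, hi⟩, hi.symm⟩
  have h2 : Function.Injective fun i => f u ∆ {i} :=
    (symmDiff_right_injective (f u)).comp Finset.singleton_injective
  rw [← Set.ncard_image_of_injective _ h2, h1, Set.ncard_image_of_injective _ hf.injective, ← hd u,
    ← card_neighborFinset_eq_degree, ← Set.ncard_coe_finset, coe_neighborFinset]

lemma IsCubeCoding.eq_top_of_degree_le_one [Finite ι] (hf : IsCubeCoding G f)
    (hd : IsRegularFamily (Set.range f) d) (hd1 : d ≤ 1) : G = ⊤ := by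
  ext u v
  rw [top_adj]
  refine ⟨fun h => h.ne, fun hne => ?_⟩
  have hS := hf.isometricFamily
  obtain ⟨i, hi, hui⟩ := hS _ ⟨u, rfl⟩ _ ⟨v, rfl⟩ (hf.injective.ne hne)
  by_cases h : f u ∆ {i} = f v
  · exact hf.adj_iff.2 ⟨i, h.symm⟩
  · exfalso
    obtain ⟨j, hj, huj⟩ := hS _ hui _ ⟨v, rfl⟩ h
    have hij : i ≠ j := by
      rintro rfl
      grind [Finset.mem_symmDiff]
    have h1 : 1 < {l | f u ∆ {i} ∆ {l} ∈ Set.range f}.ncard :=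
      (Set.one_lt_ncard).2 ⟨i, by simp, j, huj, hij⟩
    rw [hd _ hui] at h1
    omega

lemma IsCubeCoding.two_le_degree [Fintype V] [Nonempty V] [DecidableRel G.Adj] [Finite ι]
    (hf : IsCubeCoding G f) (hd : G.IsRegularOfDegree d)
    (hK1 : ¬ Nonempty (G ≃g (⊤ : SimpleGraph (Fin 1))))
    (hK2 : ¬ Nonempty (G ≃g (⊤ : SimpleGraph (Fin 2)))) : 2 ≤ d := by
  by_contra! hlt
  have hreg := hf.isRegularFamily hd
  have htop := hf.eq_top_of_degree_le_one hreg (by omega)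
  have hcard : Fintype.card V = d + 1 := by
    classical
    obtain ⟨v⟩ := ‹Nonempty V›
    have h1 := hd v
    rw [← card_neighborFinset_eq_degree] at h1
    have h2 : G.neighborFinset v = Finset.univ.erase v := by
      ext w; subst htop; simp [eq_comm]
    rw [h2, Finset.card_erase_of_mem (Finset.mem_univ v), Finset.card_univ] at h1
    have := Fintype.card_pos_iff.2 ⟨v⟩
    omega
  have hiso : Nonempty (G ≃g (⊤ : SimpleGraph (Fin (d + 1)))) :=
    ⟨htop ▸ Iso.completeGraph (Fintype.equivFinOfCardEq hcard)⟩
  interval_cases d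
  · exact hK1 hiso
  · exact hK2 hiso

lemma IsRegularFamily.exists_consecutiveEdges [Finite ι] {S : Set (Finset ι)}
    (hS : IsometricFamily S) (hne : S.Nonempty) (hd : IsRegularFamily S d) (hd2 : 2 ≤ d) :
    ∃ i a c, ConsecutiveEdges S i a c := by
  obtain ⟨v, hv⟩ := hne
  -- at a vertex `w` farthest from `v`, all directions lead towards `v`
  obtain ⟨w, hw, hmax⟩ := Set.exists_max_image S (fun w => #(w ∆ v)) (Set.toFinite _) ⟨v, hv⟩
  have hdir : ∀ i, w ∆ {i} ∈ S → i ∈ w ∆ v := by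
    intro i hi
    by_contra hni
    have := hmax _ hi
    rw [symmDiff_singleton_symmDiff_of_notMem hni, Finset.card_insert_of_notMem hni] at this
    omega
  have h1 : 1 < {i | w ∆ {i} ∈ S}.ncard := by rw [hd w hw]; omega
  obtain ⟨i, hi, s, hs, his⟩ := (Set.one_lt_ncard).1 h1
  obtain ⟨c, hc, -⟩ := hS.exists_consecutiveEdges_of_two hw hv hi hs (hdir i hi) (hdir s hs)
    (Ne.symm his)
  exact ⟨i, w, c, hc⟩

/-- Consecutive edges span a convex cycle, whose length is known. -/
lemma IsCubeCoding.hasGap {k : ℕ} (hf : IsCubeCoding G f)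
    (h : G.AllConvexCyclesHaveLength (2 * (k + 1))) : HasGap (Set.range f) k := by
  intro i a c hac
  obtain ⟨a, rfl⟩ := hac.left_mem
  obtain ⟨c, rfl⟩ := hac.right_mem
  obtain ⟨v, p, hp, hconv, hlen⟩ := hf.exists_convex_cycle hac
  have := h v p hp hconv
  omega

end PartialCube

/-! ### Renumbering coordinates -/

section Relabel

variable {ι : Type*} [DecidableEq ι] {W : Finset ι} {n : ℕ}

/-- The finite set `A`, restricted to `W`, transported along a numbering of `W`. -/
def relabel (e : W ≃ Fin n) (A : Finset ι) : Finset (Fin n) :=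
  {t | (e.symm t : ι) ∈ A}

lemma relabel_symmDiff (e : W ≃ Fin n) (A B : Finset ι) :
    relabel e A ∆ relabel e B = relabel e (A ∆ B) := by
  ext t; simp [relabel, Finset.mem_symmDiff]

lemma card_relabel (e : W ≃ Fin n) {A : Finset ι} (hA : A ⊆ W) : #(relabel e A) = #A := by
  refine Finset.card_bij' (fun t _ => (e.symm t : ι)) (fun i hi => e ⟨i, hA hi⟩) ?_ ?_ ?_ ?_
  · intro t ht; simpa [relabel] using ht
  · intro i hi; simpa [relabel] using hi
  · intro t ht; simp
  · intro i hi; simp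

lemma exists_relabel_eq (e : W ≃ Fin n) (T : Finset (Fin n)) : ∃ A ⊆ W, relabel e A = T := by
  refine ⟨T.image fun t => (e.symm t : ι), ?_, ?_⟩
  · intro i hi
    obtain ⟨t, -, rfl⟩ := Finset.mem_image.1 hi
    exact (e.symm t).2
  · ext t
    simp [relabel, Subtype.ext_iff.symm]

end Relabel

/-! ### Gap one: hypercubes -/

section Hypercube

open SimpleGraph

variable {V ι : Type*} [DecidableEq ι] [Finite ι] {G : SimpleGraph V} {f : V → Finset ι} {d : ℕ}

theorem IsCubeCoding.nonempty_iso_hypercubeGraph [Nonempty V] (hf : IsCubeCoding G f)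
    (hk : HasGap (Set.range f) 1) (hd : IsRegularFamily (Set.range f) d) :
    Nonempty (G ≃g hypercubeGraph d) := by
  have hS := hf.isometricFamily
  obtain ⟨v₀⟩ := ‹Nonempty V›
  have hfin : {i | f v₀ ∆ {i} ∈ Set.range f}.Finite := Set.toFinite _
  set W : Finset ι := hfin.toFinset with hW
  have hWcard : #W = d := by rw [← hd (f v₀) ⟨v₀, rfl⟩, Set.ncard_eq_toFinset_card _ hfin]
  have hmem : ∀ v i, f v ∆ {i} ∈ Set.range f ↔ i ∈ W := by
    intro v i
    rw [hW, Set.Finite.mem_toFinset]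
    exact ⟨flip_mem_of_gap_one hS hk hd _ _ ⟨v, rfl⟩ _ ⟨v₀, rfl⟩ rfl,
      flip_mem_of_gap_one hS hk hd _ _ ⟨v₀, rfl⟩ _ ⟨v, rfl⟩ rfl⟩
  have hsub : ∀ u v, f u ∆ f v ⊆ W := by
    intro u v i hi
    obtain ⟨_, ⟨z, rfl⟩, hzi, -, -⟩ := hS.exists_edge_of_mem_symmDiff ⟨u, rfl⟩ ⟨v, rfl⟩ hi
    exact (hmem z i).1 hzi
  have hsurj : ∀ A : Finset ι, A ⊆ W → ∃ v, f v ∆ f v₀ = A := by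
    intro A
    induction A using Finset.induction_on with
    | empty => intro _; exact ⟨v₀, by simp⟩
    | insert i A hi ih =>
      intro hA
      obtain ⟨v, hv⟩ := ih ((Finset.subset_insert _ _).trans hA)
      obtain ⟨v', hv'⟩ := (hmem v i).2 (hA (Finset.mem_insert_self _ _))
      exact ⟨v', by rw [hv', symmDiff_singleton_symmDiff_of_notMem (by rwa [hv]), hv]⟩
  let e : W ≃ Fin d := W.equivFinOfCardEq hWcard
  let g : V → Fin d → Bool := fun v t => decide (t ∈ relabel e (f v ∆ f v₀))
  have hdist : ∀ u v, hammingDist (g u) (g v) = #(f u ∆ f v) := by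
    intro u v
    have h1 : (f u ∆ f v₀) ∆ (f v ∆ f v₀) = f u ∆ f v := by
      ext t; grind [Finset.mem_symmDiff]
    rw [← card_relabel e (hsub u v), ← h1, ← relabel_symmDiff, hammingDist]
    congr 1
    ext t
    simp only [g, ne_eq, decide_eq_decide, Finset.mem_filter, Finset.mem_univ, true_and,
      Finset.mem_symmDiff]
    tauto
  have hbij : Function.Bijective g := by
    constructor
    · intro u v huv
      apply hf.injective
      rw [← hammingDist_eq_zero, hdist, Finset.card_eq_zero] at huv
      exact symmDiff_eq_bot.1 huv
    · intro b
      obtain ⟨A, hA, hAb⟩ := exists_relabel_eq e ({t | b t = true} : Finset (Fin d))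
      obtain ⟨v, hv⟩ := hsurj A hA
      refine ⟨v, ?_⟩
      ext t
      simp [g, hv, hAb]
  refine ⟨⟨Equiv.ofBijective g hbij, ?_⟩⟩
  intro u v
  rw [hf.adj_iff_card, ← hdist]
  rfl

end Hypercube

/-! ### Gap two: Doubled Odd graphs -/

section DoubledOdd

open SimpleGraph

variable {ι : Type*} [DecidableEq ι] {S : Set (Finset ι)} {d : ℕ} {x A B s t : Finset ι} {i j : ι}

/-- The directions at `x` form the set `A`, and at each neighbour of `x` they form the set `B`
together with the direction back to `x`. -/
structure SplitsDirections (S : Set (Finset ι)) (x A B : Finset ι) : Prop where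
  flip_mem : ∀ i, x ∆ {i} ∈ S ↔ i ∈ A
  flip_flip_mem : ∀ j ∈ A, ∀ i, (x ∆ {j}) ∆ {i} ∈ S ↔ i ∈ insert j B

/-- A family with gap `2` contains no squares. -/
lemma HasGap.flip_flip_notMem (hS : IsometricFamily S) (hk : HasGap S 2) (hx : x ∈ S)
    (hi : x ∆ {i} ∈ S) (hj : x ∆ {j} ∈ S) (hij : i ≠ j) : (x ∆ {j}) ∆ {i} ∉ S := by
  intro h
  refine hij (hk.eq_of_mem_symmDiff (w := (x ∆ {j}) ∆ {i}) hS hx h ?_ ?_ ?_ hj hi)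
  · rw [symmDiff_assoc, symmDiff_symmDiff_cancel_left]
    refine (Finset.card_le_card (Finset.symmDiff_subset_union)).trans ?_
    exact (Finset.card_union_le _ _).trans (by simp)
  · rw [symmDiff_assoc, symmDiff_symmDiff_cancel_left]
    simp [Finset.mem_symmDiff, Ne.symm hij]
  · rw [symmDiff_assoc, symmDiff_symmDiff_cancel_left]
    simp [Finset.mem_symmDiff, hij]

lemma SplitsDirections.of_gap_two [Finite ι] (hS : IsometricFamily S) (hk : HasGap S 2)
    (hd : IsRegularFamily S d) (hx : x ∈ S) (hA : ∀ i, x ∆ {i} ∈ S ↔ i ∈ A) (hj : j ∈ A)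
    (hB : ∀ i, (x ∆ {j}) ∆ {i} ∈ S ↔ i ∈ insert j B) (hjB : j ∉ B) :
    SplitsDirections S x A B := by
  refine ⟨hA, fun l hl i => ?_⟩
  have hjS := (hA j).2 hj
  have hlS := (hA l).2 hl
  rw [Finset.mem_insert]
  by_cases hil : i = l
  · subst hil
    simpa using hx
  constructor
  · intro h
    have h1 := flip_mem_of_gap_two hS hk hd hx hlS hjS h hil
    rw [hB, Finset.mem_insert] at h1
    rcases h1 with rfl | h1
    · exact absurd h (hk.flip_flip_notMem hS hx hjS hlS hil)
    · exact Or.inr h1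
  · rintro (h | h)
    · exact absurd h hil
    · exact flip_mem_of_gap_two hS hk hd hx hjS hlS ((hB i).2 (Finset.mem_insert_of_mem h))
        (by rintro rfl; exact hjB h)

/-- Moving to a neighbour in direction `j` exchanges the two sets of directions, up to `j`. -/
lemma SplitsDirections.flip [Finite ι] (hS : IsometricFamily S) (hk : HasGap S 2)
    (hd : IsRegularFamily S d) (h : SplitsDirections S x A B) (hj : j ∈ A) :
    SplitsDirections S (x ∆ {j}) (insert j B) (A.erase j) := by
  refine .of_gap_two hS hk hd ((h.flip_mem j).2 hj) (h.flip_flip_mem j hj)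
    (Finset.mem_insert_self j B) ?_ (Finset.notMem_erase j A)
  intro i
  rw [Finset.insert_erase hj, symmDiff_symmDiff_cancel_right]
  exact h.flip_mem i

/-- Adjacency in the Doubled Odd graph means differing in exactly one element. -/
lemma card_symmDiff_eq_one_iff (hd : 1 ≤ d) (hs : #s = d - 1 ∨ #s = d) (ht : #t = d - 1 ∨ #t = d) :
    #(s ∆ t) = 1 ↔ (#s = d - 1 ∧ #t = d ∧ s ⊂ t) ∨ (#t = d - 1 ∧ #s = d ∧ t ⊂ s) := by
  have hsd : #(s ∆ t) = #(s \ t) + #(t \ s) := by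
    rw [symmDiff_def]
    exact Finset.card_union_of_disjoint disjoint_sdiff_sdiff
  have h1 := Finset.card_sdiff_add_card_inter s t
  have h2 := Finset.card_sdiff_add_card_inter t s
  rw [Finset.inter_comm] at h2
  constructor
  · intro h
    rcases hs with hs | hs
    · left
      have h3 : #(s \ t) = 0 := by omega
      have h4 : #t = d := by omega
      rw [Finset.card_eq_zero, Finset.sdiff_eq_empty_iff_subset] at h3
      exact ⟨hs, h4, Finset.ssubset_iff_subset_ne.2 ⟨h3, by rintro rfl; omega⟩⟩
    · right
      have h3 : #(t \ s) = 0 := by omega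
      have h4 : #t = d - 1 := by omega
      rw [Finset.card_eq_zero, Finset.sdiff_eq_empty_iff_subset] at h3
      exact ⟨h4, hs, Finset.ssubset_iff_subset_ne.2 ⟨h3, by rintro rfl; omega⟩⟩
  · rintro (⟨hs, ht, hst⟩ | ⟨ht, hs, hst⟩)
    · have h3 := Finset.sdiff_eq_empty_iff_subset.2 hst.subset
      rw [h3, Finset.card_empty] at h1
      rw [hsd, h3, Finset.card_empty]; omega
    · have h3 := Finset.sdiff_eq_empty_iff_subset.2 hst.subset
      rw [h3, Finset.card_empty] at h2
      rw [hsd, h3, Finset.card_empty]; omega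

theorem IsCubeCoding.nonempty_iso_doubledOddGraph [Finite ι] {V : Type*} {G : SimpleGraph V}
    {f : V → Finset ι} [Nonempty V] (hf : IsCubeCoding G f)
    (hk : HasGap (Set.range f) 2) (hd : IsRegularFamily (Set.range f) d) (hd1 : 1 ≤ d) :
    Nonempty (G ≃g doubledOddGraph d) := by
  have hS := hf.isometricFamily
  obtain ⟨v₀⟩ := ‹Nonempty V›
  have hfin : ∀ x, {i | x ∆ {i} ∈ Set.range f}.Finite := fun x => Set.toFinite _
  set A : Finset ι := (hfin (f v₀)).toFinset with hAdef
  have hA : ∀ i, f v₀ ∆ {i} ∈ Set.range f ↔ i ∈ A := by simp [hAdef]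
  have hAcard : #A = d := by rw [← hd (f v₀) ⟨v₀, rfl⟩, Set.ncard_eq_toFinset_card _ (hfin _)]
  obtain ⟨j, hj⟩ : A.Nonempty := by rw [← Finset.card_pos]; omega
  have hjS := (hA j).2 hj
  set B : Finset ι := ((hfin (f v₀ ∆ {j})).toFinset).erase j with hBdef
  have hjB : j ∈ (hfin (f v₀ ∆ {j})).toFinset := by simp
  have hB : ∀ i, (f v₀ ∆ {j}) ∆ {i} ∈ Set.range f ↔ i ∈ insert j B := by
    intro i
    rw [hBdef, Finset.insert_erase hjB, Set.Finite.mem_toFinset]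
    rfl
  have hBcard : #B = d - 1 := by
    rw [hBdef, Finset.card_erase_of_mem hjB, ← hd _ hjS, Set.ncard_eq_toFinset_card _ (hfin _)]
  have hAB : Disjoint A B := by
    rw [Finset.disjoint_left]
    intro i hi hiB
    refine hk.flip_flip_notMem hS ⟨v₀, rfl⟩ ((hA i).2 hi) hjS ?_
      ((hB i).2 (Finset.mem_insert_of_mem hiB))
    rintro rfl
    exact Finset.notMem_erase _ _ hiB
  set W := A ∪ B with hW
  have hWcard : #W = 2 * d - 1 := by
    rw [hW, Finset.card_union_of_disjoint hAB]; omega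
  set h : V → Finset ι := fun v => (f v ∆ f v₀) ∆ B with hh
  have hstep : ∀ {u v : V} {i : ι}, f v = f u ∆ {i} → h v = h u ∆ {i} := by
    intro u v i huv
    simp only [hh, huv]
    ext t; grind [Finset.mem_symmDiff]
  -- the position `h v` determines the directions at `v`: its complement in `W` when it has
  -- `d - 1` elements, itself when it has `d` elements
  let P : V → Prop := fun v => h v ⊆ W ∧
      ((#(h v) = d - 1 ∧ SplitsDirections (Set.range f) (f v) (W \ h v) (h v)) ∨
        (#(h v) = d ∧ SplitsDirections (Set.range f) (f v) (h v) (W \ h v)))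
  have hP : ∀ v, P v := by
    have hadj : ∀ u v, G.Adj u v → P u → P v := by
      rintro u v huv ⟨hu, hc | hc⟩
      · obtain ⟨i, hi⟩ := hf.adj_iff.1 huv
        have hiA : i ∈ W \ h u := (hc.2.flip_mem i).1 ⟨v, hi⟩
        have hi' := Finset.mem_sdiff.1 hiA
        have hv : h v = insert i (h u) := by
          rw [hstep hi]; ext t; grind [Finset.mem_symmDiff]
        have hv' : (W \ h u).erase i = W \ h v := by
          rw [hv]; ext t; grind
        have hsp := hc.2.flip hS hk hd hiA
        rw [hv', ← hv, ← hi] at hsp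
        refine ⟨by rw [hv]; exact Finset.insert_subset hi'.1 hu, Or.inr ⟨?_, hsp⟩⟩
        rw [hv, Finset.card_insert_of_notMem hi'.2]; omega
      · obtain ⟨i, hi⟩ := hf.adj_iff.1 huv
        have hiA : i ∈ h u := (hc.2.flip_mem i).1 ⟨v, hi⟩
        have hv : h v = (h u).erase i := by
          rw [hstep hi]; ext t; grind [Finset.mem_symmDiff]
        have hv' : insert i (W \ h u) = W \ h v := by
          have := hu hiA
          rw [hv]; ext t; grind
        have hsp := hc.2.flip hS hk hd hiA
        rw [hv', ← hv, ← hi] at hsp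
        refine ⟨by rw [hv]; exact (Finset.erase_subset _ _).trans hu, Or.inl ⟨?_, hsp⟩⟩
        rw [hv, Finset.card_erase_of_mem hiA]; omega
    have hwalk : ∀ {u v : V} (p : G.Walk u v), P u → P v := by
      intro u v p
      induction p with
      | nil => exact id
      | cons huv p ih => exact fun hu => ih (hadj _ _ huv hu)
    intro v
    obtain ⟨p⟩ := hf.connected v₀ v
    refine hwalk p ?_
    have h0 : h v₀ = B := by simp [hh]
    have hWB : W \ B = A := by rw [hW, Finset.union_sdiff_cancel_right hAB]
    simp only [P]
    rw [h0, hWB]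
    exact ⟨Finset.subset_union_right, Or.inl ⟨hBcard,
      .of_gap_two hS hk hd ⟨v₀, rfl⟩ hA hj hB (Finset.notMem_erase _ _)⟩⟩
  have hdist : ∀ u v, h u ∆ h v = f u ∆ f v := by
    intro u v; simp only [hh]; ext t; grind [Finset.mem_symmDiff]
  have hsurj : ∀ n, ∀ v, ∀ T ⊆ W, (#T = d - 1 ∨ #T = d) → #(h v ∆ T) = n → ∃ u, h u = T := by
    intro n
    induction n with
    | zero =>
      intro v T _ _ h0
      exact ⟨v, symmDiff_eq_bot.1 (Finset.card_eq_zero.1 h0)⟩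
    | succ n ih =>
      intro v T hT hTc hn
      have hne : h v ≠ T := by rintro rfl; simp at hn
      -- some direction at `v` brings the position nearer to `T`
      obtain ⟨i, hi, hiS⟩ : ∃ i ∈ h v ∆ T, f v ∆ {i} ∈ Set.range f := by
        obtain ⟨hvW, hc | hc⟩ := hP v
        · have hnot : ¬ T ⊆ h v := fun hsub =>
            hne (Finset.eq_of_subset_of_card_le hsub (by omega)).symm
          obtain ⟨i, hiT, hiv⟩ := Finset.not_subset.1 hnot
          exact ⟨i, Finset.mem_symmDiff.2 (Or.inr ⟨hiT, hiv⟩),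
            (hc.2.flip_mem i).2 (Finset.mem_sdiff.2 ⟨hT hiT, hiv⟩)⟩
        · have hnot : ¬ h v ⊆ T := fun hsub =>
            hne (Finset.eq_of_subset_of_card_le hsub (by omega))
          obtain ⟨i, hiv, hiT⟩ := Finset.not_subset.1 hnot
          exact ⟨i, Finset.mem_symmDiff.2 (Or.inl ⟨hiv, hiT⟩), (hc.2.flip_mem i).2 hiv⟩
      obtain ⟨v', hv'⟩ := hiS
      refine ih v' T hT hTc ?_
      rw [hstep hv', symmDiff_singleton_symmDiff_of_mem hi, Finset.card_erase_of_mem hi, hn]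
      rfl
  let e : W ≃ Fin (2 * d - 1) := W.equivFinOfCardEq hWcard
  have hcard : ∀ v, #(relabel e (h v)) = d - 1 ∨ #(relabel e (h v)) = d := by
    intro v
    rw [card_relabel e (hP v).1]
    exact (hP v).2.imp And.left And.left
  have hdist' : ∀ u v, #(relabel e (h u) ∆ relabel e (h v)) = #(f u ∆ f v) := by
    intro u v
    have hsub : h u ∆ h v ⊆ W := by
      intro t ht
      have h1 := (hP u).1
      have h2 := (hP v).1
      have h3 := @h1 t
      have h4 := @h2 t
      grind [Finset.mem_symmDiff]
    rw [relabel_symmDiff, card_relabel e hsub, hdist]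
  let g : V → {s : Finset (Fin (2 * d - 1)) // #s = d - 1 ∨ #s = d} :=
    fun v => ⟨relabel e (h v), hcard v⟩
  have hbij : Function.Bijective g := by
    constructor
    · intro u v huv
      have huv' : relabel e (h u) = relabel e (h v) := congrArg Subtype.val huv
      have h1 := hdist' u v
      rw [huv', symmDiff_self, Finset.bot_eq_empty, Finset.card_empty, eq_comm,
        Finset.card_eq_zero] at h1
      exact hf.injective (symmDiff_eq_bot.1 h1)
    · rintro ⟨T, hT⟩
      obtain ⟨A', hA', rfl⟩ := exists_relabel_eq e T
      rw [card_relabel e hA'] at hT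
      obtain ⟨u, hu⟩ := hsurj _ v₀ A' hA' hT rfl
      exact ⟨u, Subtype.ext (by simp only [g, hu])⟩
  refine ⟨⟨Equiv.ofBijective g hbij, ?_⟩⟩
  intro u v
  rw [hf.adj_iff_card, ← hdist', card_symmDiff_eq_one_iff hd1 (hcard u) (hcard v)]
  rfl

end DoubledOdd

/-! ### Cycles inside connected graphs of degree two -/

section Cycle

open SimpleGraph

lemma ncard_neighborSet_cycleGraph {m : ℕ} (hm : 3 ≤ m) (v : Fin m) :
    ((cycleGraph m).neighborSet v).ncard = 2 := by
  obtain ⟨n, rfl⟩ := Nat.exists_eq_add_of_le' hm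
  rw [← cycleGraph_degree_three_le (v := v), ← card_neighborFinset_eq_degree,
    ← Set.ncard_coe_finset, coe_neighborFinset]

/-- A connected graph of degree two is any one of its cycles, since the cycle already uses up all the
degrees. -/
theorem SimpleGraph.Walk.IsCycle.nonempty_cycleGraph_iso {V : Type*} {G : SimpleGraph V}
    (hG : G.Connected) (h2 : ∀ v, (G.neighborSet v).ncard = 2) {u : V} {p : G.Walk u u}
    (hp : p.IsCycle) : Nonempty (cycleGraph p.length ≃g G) := by
  have hm := hp.three_le_length
  obtain ⟨g⟩ := (cycleGraph_isContained_iff (by omega)).2 ⟨u, p, hp, rfl⟩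
  have hnb : ∀ v, g '' (cycleGraph p.length).neighborSet v = G.neighborSet (g v) := by
    intro v
    apply Set.eq_of_subset_of_ncard_le
    · rintro _ ⟨w, hw, rfl⟩
      exact g.toHom.map_adj hw
    · rw [h2, Set.ncard_image_of_injective (f := g) _ g.injective, ncard_neighborSet_cycleGraph hm]
    · exact Set.finite_of_ncard_pos (by rw [h2]; norm_num)
  have hsurj : Function.Surjective g := by
    have hwalk : ∀ {x y : V} (q : G.Walk x y), x ∈ Set.range g → y ∈ Set.range g := by
      intro x y q
      induction q with
      | nil => exact id
      | cons h q ih =>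
        rintro ⟨v, rfl⟩
        apply ih
        have h1 : _ ∈ G.neighborSet (g v) := h
        rw [← hnb] at h1
        obtain ⟨w, -, hw⟩ := h1
        exact ⟨w, hw⟩
    intro y
    obtain ⟨q⟩ := hG (g ⟨0, by omega⟩) y
    exact hwalk q ⟨_, rfl⟩
  refine ⟨⟨Equiv.ofBijective g ⟨g.injective, hsurj⟩, ?_⟩⟩
  intro v w
  change G.Adj (g v) (g w) ↔ _
  constructor
  · intro h
    have h1 : g w ∈ G.neighborSet (g v) := h
    rw [← hnb] at h1
    obtain ⟨w', hw', he⟩ := h1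
    rwa [← g.injective he]
  · exact fun h => g.toHom.map_adj h

lemma SimpleGraph.Walk.IsCycle.mapToSubgraph {V : Type*} {G : SimpleGraph V} {u : V}
    {p : G.Walk u u} (hp : p.IsCycle) : p.mapToSubgraph.IsCycle := by
  refine IsCycle.of_map (f := p.toSubgraph.hom) ?_
  rw [Walk.map_mapToSubgraph_hom]
  exact hp

/-- A cycle running inside another cycle is the whole of it. -/
theorem SimpleGraph.Walk.IsCycle.length_eq_of_toSubgraph_le {V : Type*} {G : SimpleGraph V}
    {u v : V} {p : G.Walk u u} {q : G.Walk v v} (hp : p.IsCycle) (hq : q.IsCycle)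
    (hle : p.toSubgraph ≤ q.toSubgraph) : p.length = q.length := by
  have hconn : q.toSubgraph.coe.Connected := q.toSubgraph_connected.coe
  have h2 : ∀ x, (q.toSubgraph.coe.neighborSet x).ncard = 2 := by
    intro x
    rw [← hq.ncard_neighborSet_toSubgraph_eq_two ((q.mem_verts_toSubgraph).1 x.2),
      ← Set.ncard_image_of_injective _ Subtype.val_injective]
    congr 1
    ext y
    constructor
    · rintro ⟨y, hy, rfl⟩
      exact hy
    · intro hy
      exact ⟨⟨y, q.toSubgraph.edge_vert (Subgraph.Adj.symm hy)⟩, hy, rfl⟩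
  have hp' := hp.mapToSubgraph.map (Subgraph.inclusion.injective hle)
  obtain ⟨e₁⟩ := hp'.nonempty_cycleGraph_iso hconn h2
  obtain ⟨e₂⟩ := hq.mapToSubgraph.nonempty_cycleGraph_iso hconn h2
  have := Fintype.card_congr (e₁.toEquiv.trans e₂.symm.toEquiv)
  rw [Fintype.card_fin, Fintype.card_fin] at this
  rwa [Walk.length_map, length_mapToSubgraph, length_mapToSubgraph] at this

end Cycle

/-! ### Convex cycles of hypercubes and Doubled Odd graphs -/

section Converse

open SimpleGraph

variable {V ι : Type*} [DecidableEq ι] {G : SimpleGraph V} {f : V → Finset ι}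

lemma hypercubeGraph_exists_other_middle {n : ℕ} {x y z : Fin n → Bool}
    (hxy : (hypercubeGraph n).Adj x y) (hyz : (hypercubeGraph n).Adj y z) (hxz : x ≠ z) :
    ∃ y', y' ≠ y ∧ (hypercubeGraph n).Adj x y' ∧ (hypercubeGraph n).Adj y' z := by
  change hammingDist _ _ = 1 at hxy hyz
  -- make the two flips in the opposite order
  refine ⟨fun t => (x t ^^ y t) ^^ z t, ?_, ?_, ?_⟩
  · intro h
    apply hxz
    ext t
    have := congrFun h t
    revert this
    cases x t <;> cases y t <;> cases z t <;> simp
  · change hammingDist _ _ = 1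
    rw [← hyz, hammingDist, hammingDist]
    congr 1
    ext t
    cases hx : x t <;> cases hy : y t <;> cases hz : z t <;> simp [hx, hy, hz]
  · change hammingDist _ _ = 1
    rw [← hxy, hammingDist, hammingDist]
    congr 1
    ext t
    cases hx : x t <;> cases hy : y t <;> cases hz : z t <;> simp [hx, hy, hz]

/-- A path from a `(d - 1)`-subset adds `i`, removes `j` and adds `l`; the other geodesic adds `l`,
removes `j` and adds `i`. -/
lemma doubledOddGraph_exists_other_path_of_card {d : ℕ} (hd : 1 ≤ d)
    {v₀ v₁ v₂ v₃ : {s : Finset (Fin (2 * d - 1)) // #s = d - 1 ∨ #s = d}} (hc : #v₀.1 = d - 1)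
    (h₁ : (doubledOddGraph d).Adj v₀ v₁) (h₂ : (doubledOddGraph d).Adj v₁ v₂)
    (h₃ : (doubledOddGraph d).Adj v₂ v₃) (h₀₂ : v₀ ≠ v₂) (h₁₃ : v₁ ≠ v₃) :
    ¬ (doubledOddGraph d).Adj v₀ v₃ ∧ ∃ a b, (doubledOddGraph d).Adj v₀ a ∧
      (doubledOddGraph d).Adj a b ∧ (doubledOddGraph d).Adj b v₃ ∧ a ≠ v₁ ∧ b ≠ v₂ := by
  obtain ⟨s₀, hs₀⟩ := v₀
  obtain ⟨s₁, hs₁⟩ := v₁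
  obtain ⟨s₂, hs₂⟩ := v₂
  obtain ⟨s₃, hs₃⟩ := v₃
  simp only [ne_eq, Subtype.mk.injEq] at h₀₂ h₁₃
  simp only at hc
  replace h₁ : (#s₀ = d - 1 ∧ #s₁ = d ∧ s₀ ⊂ s₁) ∨ (#s₁ = d - 1 ∧ #s₀ = d ∧ s₁ ⊂ s₀) := h₁
  replace h₂ : (#s₁ = d - 1 ∧ #s₂ = d ∧ s₁ ⊂ s₂) ∨ (#s₂ = d - 1 ∧ #s₁ = d ∧ s₂ ⊂ s₁) := h₂
  replace h₃ : (#s₂ = d - 1 ∧ #s₃ = d ∧ s₂ ⊂ s₃) ∨ (#s₃ = d - 1 ∧ #s₂ = d ∧ s₃ ⊂ s₂) := h₃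
  obtain ⟨-, c₁, h₁⟩ := h₁.resolve_right (by omega)
  obtain ⟨c₂, -, h₂⟩ := h₂.resolve_left (by omega)
  obtain ⟨-, c₃, h₃⟩ := h₃.resolve_right (by omega)
  obtain ⟨i, hi, rfl⟩ := (Finset.covBy_iff_exists_insert.1
    (Finset.covBy_iff_card_sdiff_eq_one.2 ⟨h₁.subset, by
      rw [Finset.card_sdiff_of_subset h₁.subset]; omega⟩))
  obtain ⟨j, hj, e₂⟩ := (Finset.covBy_iff_exists_insert.1
    (Finset.covBy_iff_card_sdiff_eq_one.2 ⟨h₂.subset, by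
      rw [Finset.card_sdiff_of_subset h₂.subset]; omega⟩))
  obtain ⟨l, hl, rfl⟩ := (Finset.covBy_iff_exists_insert.1
    (Finset.covBy_iff_card_sdiff_eq_one.2 ⟨h₃.subset, by
      rw [Finset.card_sdiff_of_subset h₃.subset]; omega⟩))
  have hij : i ≠ j := by
    rintro rfl
    apply h₀₂
    ext t
    have := congrArg (t ∈ ·) e₂
    grind
  have hlj : l ≠ j := fun h => h₁₃ (by rw [h, e₂])
  have hmem : ∀ t, t ∈ s₂ ↔ t ≠ j ∧ (t = i ∨ t ∈ s₀) := by
    intro t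
    have := congrArg (t ∈ ·) e₂
    grind
  have hj₀ : j ∈ s₀ := by
    have := congrArg (j ∈ ·) e₂
    grind
  have hl₀ : l ∉ s₀ := fun h => hl ((hmem l).2 ⟨hlj, Or.inr h⟩)
  have hil : i ≠ l := by
    rintro rfl
    exact hl ((hmem i).2 ⟨hij, Or.inl rfl⟩)
  have ca : #(insert l s₀) = d := by rw [Finset.card_insert_of_notMem hl₀]; omega
  have cb : #((insert l s₀).erase j) = d - 1 := by
    rw [Finset.card_erase_of_mem (Finset.mem_insert_of_mem hj₀), ca]
  refine ⟨?_, ⟨insert l s₀, Or.inr ca⟩, ⟨(insert l s₀).erase j, Or.inl cb⟩,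
    Or.inl ⟨hc, ca, Finset.ssubset_insert hl₀⟩,
    Or.inr ⟨cb, ca, Finset.erase_ssubset (Finset.mem_insert_of_mem hj₀)⟩,
    Or.inl ⟨cb, c₃, Finset.ssubset_iff_subset_ne.2 ⟨fun t ht => ?_, fun h => ?_⟩⟩, ?_, ?_⟩
  · rintro (⟨-, -, h⟩ | ⟨h, -⟩)
    · have := h.subset hj₀
      grind
    · exact absurd (h.symm.trans c₃) (by omega)
  · grind
  · have := congrArg Finset.card h
    simp only at this
    omega
  · intro h
    have := congrArg (l ∈ ·) (congrArg Subtype.val h)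
    grind
  · intro h
    have := congrArg (l ∈ ·) (congrArg Subtype.val h)
    grind

lemma doubledOddGraph_exists_other_path {d : ℕ} (hd : 1 ≤ d)
    {v₀ v₁ v₂ v₃ : {s : Finset (Fin (2 * d - 1)) // #s = d - 1 ∨ #s = d}}
    (h₁ : (doubledOddGraph d).Adj v₀ v₁) (h₂ : (doubledOddGraph d).Adj v₁ v₂)
    (h₃ : (doubledOddGraph d).Adj v₂ v₃) (h₀₂ : v₀ ≠ v₂) (h₁₃ : v₁ ≠ v₃) :
    ¬ (doubledOddGraph d).Adj v₀ v₃ ∧ ∃ a b, (doubledOddGraph d).Adj v₀ a ∧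
      (doubledOddGraph d).Adj a b ∧ (doubledOddGraph d).Adj b v₃ ∧ a ≠ v₁ ∧ b ≠ v₂ := by
  rcases v₀.2 with hc | hc
  · exact doubledOddGraph_exists_other_path_of_card hd hc h₁ h₂ h₃ h₀₂ h₁₃
  · -- the reversed path starts at a `(d - 1)`-subset
    have hc₃ : #v₃.1 = d - 1 := by
      rcases h₁ with h₁ | h₁ <;> rcases h₂ with h₂ | h₂ <;> rcases h₃ with h₃ | h₃ <;> omega
    obtain ⟨hn, a, b, ha, hab, hb, ha', hb'⟩ := doubledOddGraph_exists_other_path_of_card hd hc₃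
      h₃.symm h₂.symm h₁.symm h₁₃.symm h₀₂.symm
    exact ⟨fun h => hn h.symm, b, a, hb.symm, hab.symm, ha.symm, hb', ha'⟩

lemma IsCubeCoding.dist_eq_two (hf : IsCubeCoding G f) {x y z : V} (hxy : G.Adj x y)
    (hyz : G.Adj y z) (hxz : x ≠ z) : G.dist x z = 2 := by
  obtain ⟨i, hi⟩ := hf.adj_iff.1 hxy
  obtain ⟨j, hj⟩ := hf.adj_iff.1 hyz
  have hij : i ≠ j := by
    rintro rfl
    exact hxz (hf.injective (by rw [hj, hi]; simp))
  rw [hf.dist_eq, hj, hi, ← Finset.card_pair hij]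
  congr 1
  ext t; grind [Finset.mem_symmDiff]

lemma IsCubeCoding.dist_eq_three (hf : IsCubeCoding G f) {x y z w : V} (hxy : G.Adj x y)
    (hyz : G.Adj y z) (hzw : G.Adj z w) (hxz : x ≠ z) (hyw : y ≠ w) (hxw : ¬ G.Adj x w) :
    G.dist x w = 3 := by
  obtain ⟨i, hi⟩ := hf.adj_iff.1 hxy
  obtain ⟨j, hj⟩ := hf.adj_iff.1 hyz
  obtain ⟨l, hl⟩ := hf.adj_iff.1 hzw
  have hij : i ≠ j := by
    rintro rfl
    exact hxz (hf.injective (by rw [hj, hi]; simp))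
  have hjl : j ≠ l := by
    rintro rfl
    exact hyw (hf.injective (by rw [hl, hj]; simp))
  have hil : i ≠ l := by
    rintro rfl
    refine hxw (hf.adj_iff.2 ⟨j, ?_⟩)
    rw [hl, hj, hi]
    ext t; grind [Finset.mem_symmDiff]
  have hcard : #({i, j, l} : Finset ι) = 3 := Finset.card_eq_three.2 ⟨i, j, l, hij, hil, hjl, rfl⟩
  rw [hf.dist_eq, ← hcard]
  congr 1
  ext t; grind [Finset.mem_symmDiff]

/-- If every path with two edges has a second geodesic between its ends, convex cycles are
squares. -/
theorem IsCubeCoding.allConvexCyclesHaveLength_four (hf : IsCubeCoding G f)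
    (h : ∀ x y z, G.Adj x y → G.Adj y z → x ≠ z → ∃ y', y' ≠ y ∧ G.Adj x y' ∧ G.Adj y' z) :
    G.AllConvexCyclesHaveLength 4 := by
  intro v c hc hconv
  have hlen := hc.three_le_length
  have a₁ := c.toSubgraph_adj_getVert (i := 0) (by omega)
  have a₂ := c.toSubgraph_adj_getVert (i := 1) (by omega)
  have h₀₂ : c.getVert 0 ≠ c.getVert 2 := fun he => by
    have := hc.getVert_injOn' (show 0 ≤ c.length - 1 by omega) (show 2 ≤ c.length - 1 by omega) he
    omega
  simp only [zero_add, Nat.reduceAdd] at a₁ a₂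
  generalize c.getVert 0 = x at *
  generalize c.getVert 1 = y at *
  generalize c.getVert 2 = z at *
  obtain ⟨y', hne, hxy', hy'z⟩ := h x y z a₁.adj_sub a₂.adj_sub h₀₂
  have hle := hconv.2 x (c.toSubgraph.edge_vert a₁) z (c.toSubgraph.edge_vert a₂.symm)
    (.cons hxy' (.cons hy'z .nil)) (by rw [hf.dist_eq_two a₁.adj_sub a₂.adj_sub h₀₂]; rfl)
  have a₃ : c.toSubgraph.Adj x y' := hle.2 (by simp [Walk.toSubgraph])
  have a₄ : c.toSubgraph.Adj y' z := hle.2 (by simp [Walk.toSubgraph])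
  let p : G.Walk x x :=
    .cons a₁.adj_sub (.cons a₂.adj_sub (.cons a₄.adj_sub.symm (.cons a₃.adj_sub.symm .nil)))
  have hp : p.IsCycle := by
    have n₁ := a₁.adj_sub.ne
    have n₂ := a₂.adj_sub.ne
    have n₃ := a₃.adj_sub.ne
    have n₄ := a₄.adj_sub.ne
    rw [Walk.isCycle_iff_isPath_tail_and_le_length]
    simp [p, n₂, n₁.symm, n₃.symm, n₄.symm, hne.symm, h₀₂.symm]
  have hpl : p.toSubgraph ≤ c.toSubgraph := by
    rw [Walk.toSubgraph_le_iff (by simp [p])]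
    intro e he
    simp only [p, Walk.edgeSet_cons, Walk.edgeSet_nil] at he
    rcases he with rfl | rfl | rfl | rfl | he
    exacts [a₁, a₂, a₄.symm, a₃.symm, he.elim]
  exact (hp.length_eq_of_toSubgraph_le hc hpl).symm

/-- If every path with three edges has ends at distance three and a disjoint second geodesic
between them, convex cycles are hexagons. -/
theorem IsCubeCoding.allConvexCyclesHaveLength_six (hf : IsCubeCoding G f)
    (h : ∀ x y z w, G.Adj x y → G.Adj y z → G.Adj z w → x ≠ z → y ≠ w →
      ¬ G.Adj x w ∧ ∃ a b, G.Adj x a ∧ G.Adj a b ∧ G.Adj b w ∧ a ≠ y ∧ b ≠ z) :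
    G.AllConvexCyclesHaveLength 6 := by
  intro v c hc hconv
  have hlen := hc.three_le_length
  have a₁ := c.toSubgraph_adj_getVert (i := 0) (by omega)
  have a₂ := c.toSubgraph_adj_getVert (i := 1) (by omega)
  have a₃ := c.toSubgraph_adj_getVert (i := 2) (by omega)
  have h₀₂ : c.getVert 0 ≠ c.getVert 2 := fun he => by
    have := hc.getVert_injOn' (show 0 ≤ c.length - 1 by omega) (show 2 ≤ c.length - 1 by omega) he
    omega
  simp only [zero_add, Nat.reduceAdd] at a₁ a₂ a₃
  have h₁₃ : c.getVert 1 ≠ c.getVert 3 := by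
    rcases hlen.lt_or_eq with hlt | heq
    · intro he
      have := hc.getVert_injOn' (show 1 ≤ c.length - 1 by omega)
        (show 3 ≤ c.length - 1 by omega) he
      omega
    · rw [heq, c.getVert_length]
      have := a₁.adj_sub.ne
      rw [c.getVert_zero] at this
      exact this.symm
  generalize c.getVert 0 = x at *
  generalize c.getVert 1 = y at *
  generalize c.getVert 2 = z at *
  generalize c.getVert 3 = w at *
  obtain ⟨hxw, a, b, hxa, hab, hbw, hay, hbz⟩ := h x y z w a₁.adj_sub a₂.adj_sub a₃.adj_sub h₀₂ h₁₃
  have hd := hf.dist_eq_three a₁.adj_sub a₂.adj_sub a₃.adj_sub h₀₂ h₁₃ hxw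
  have hle := hconv.2 x (c.toSubgraph.edge_vert a₁) w (c.toSubgraph.edge_vert a₃.symm)
    (.cons hxa (.cons hab (.cons hbw .nil))) (by rw [hd]; rfl)
  have a₄ : c.toSubgraph.Adj x a := hle.2 (by simp [Walk.toSubgraph])
  have a₅ : c.toSubgraph.Adj a b := hle.2 (by simp [Walk.toSubgraph])
  have a₆ : c.toSubgraph.Adj b w := hle.2 (by simp [Walk.toSubgraph])
  let p : G.Walk x x := .cons a₁.adj_sub (.cons a₂.adj_sub (.cons a₃.adj_sub
    (.cons a₆.adj_sub.symm (.cons a₅.adj_sub.symm (.cons a₄.adj_sub.symm .nil)))))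
  have hp : p.IsCycle := by
    -- vertices at different distances from `x` are different
    have dx : G.dist x x = 0 := dist_self
    have dy : G.dist x y = 1 := dist_eq_one_iff_adj.2 a₁.adj_sub
    have da : G.dist x a = 1 := dist_eq_one_iff_adj.2 hxa
    have dz : G.dist x z = 2 := hf.dist_eq_two a₁.adj_sub a₂.adj_sub h₀₂
    have hxb : x ≠ b := fun he => hxw (he ▸ hbw)
    have db : G.dist x b = 2 := hf.dist_eq_two hxa hab hxb
    have hne : ∀ {s t : V}, G.dist x s ≠ G.dist x t → s ≠ t := fun h he => h (he ▸ rfl)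
    have n₁ : y ≠ z := hne (by omega)
    have n₂ : y ≠ w := hne (by omega)
    have n₃ : y ≠ b := hne (by omega)
    have n₄ : y ≠ x := hne (by omega)
    have n₅ : z ≠ w := hne (by omega)
    have n₆ : z ≠ a := hne (by omega)
    have n₇ : w ≠ b := hne (by omega)
    have n₈ : w ≠ a := hne (by omega)
    have n₉ : w ≠ x := hne (by omega)
    have n₁₀ : b ≠ a := hne (by omega)
    have n₁₁ : a ≠ x := hne (by omega)
    rw [Walk.isCycle_iff_isPath_tail_and_le_length]
    simp [p, n₁, n₂, n₃, n₄, n₅, n₆, n₇, n₈, n₉, n₁₀, n₁₁, hay.symm, hbz.symm, hxb.symm, h₀₂.symm]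
  have hpl : p.toSubgraph ≤ c.toSubgraph := by
    rw [Walk.toSubgraph_le_iff (by simp [p])]
    intro e he
    simp only [p, Walk.edgeSet_cons, Walk.edgeSet_nil] at he
    rcases he with rfl | rfl | rfl | rfl | rfl | rfl | he
    exacts [a₁, a₂, a₃, a₆.symm, a₅.symm, a₄.symm, he.elim]
  exact (hp.length_eq_of_toSubgraph_le hc hpl).symm

end Converse

/-! ### The characterization -/

theorem theorem1 {V : Type*} [Fintype V] [Nonempty V] (G : SimpleGraph V) [DecidableRel G.Adj]
    (hG : G.IsPartialCube) (hreg : ∃ d : ℕ, G.IsRegularOfDegree d)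
    (hK1 : ¬ Nonempty (G ≃g (⊤ : SimpleGraph (Fin 1))))
    (hK2 : ¬ Nonempty (G ≃g (⊤ : SimpleGraph (Fin 2)))) :
    (G.AllConvexCyclesHaveLength 4 ↔ ∃ k : ℕ, 2 ≤ k ∧ Nonempty (G ≃g hypercubeGraph k)) ∧
    (G.AllConvexCyclesHaveLength 6 ↔ ∃ k : ℕ, 2 ≤ k ∧ Nonempty (G ≃g doubledOddGraph k)) ∧
    (∀ n : ℕ, 4 ≤ n →
      (G.AllConvexCyclesHaveLength (2 * n) ↔ Nonempty (G ≃g SimpleGraph.cycleGraph (2 * n)))) := by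
  obtain ⟨N, f, hf⟩ := hG.exists_isCubeCoding
  obtain ⟨d, hd⟩ := hreg
  have hd2 := hf.two_le_degree hd hK1 hK2
  have hregF := hf.isRegularFamily hd
  have hS := hf.isometricFamily
  refine ⟨⟨fun h => ?_, ?_⟩, ⟨fun h => ?_, ?_⟩, fun n hn => ⟨fun h => ?_, ?_⟩⟩
  · exact ⟨d, hd2, hf.nonempty_iso_hypercubeGraph (hf.hasGap (k := 1) h) hregF⟩
  · rintro ⟨k, -, ⟨φ⟩⟩
    refine hf.allConvexCyclesHaveLength_four fun x y z hxy hyz hxz => ?_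
    obtain ⟨y', hne, h1, h2⟩ := hypercubeGraph_exists_other_middle (φ.map_adj_iff.2 hxy)
      (φ.map_adj_iff.2 hyz) (φ.injective.ne hxz)
    obtain ⟨y', rfl⟩ := φ.surjective y'
    exact ⟨y', fun he => hne (by rw [he]), φ.map_adj_iff.1 h1, φ.map_adj_iff.1 h2⟩
  · exact ⟨d, hd2, hf.nonempty_iso_doubledOddGraph (hf.hasGap (k := 2) h) hregF (by omega)⟩
  · rintro ⟨k, hk, ⟨φ⟩⟩
    refine hf.allConvexCyclesHaveLength_six fun x y z w hxy hyz hzw hxz hyw => ?_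
    obtain ⟨hn, a, b, h1, h2, h3, h4, h5⟩ := doubledOddGraph_exists_other_path (by omega)
      (φ.map_adj_iff.2 hxy) (φ.map_adj_iff.2 hyz) (φ.map_adj_iff.2 hzw) (φ.injective.ne hxz)
      (φ.injective.ne hyw)
    obtain ⟨a, rfl⟩ := φ.surjective a
    obtain ⟨b, rfl⟩ := φ.surjective b
    exact ⟨fun he => hn (φ.map_adj_iff.2 he), a, b, φ.map_adj_iff.1 h1, φ.map_adj_iff.1 h2,
      φ.map_adj_iff.1 h3, fun he => h4 (by rw [he]), fun he => h5 (by rw [he])⟩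
  · obtain ⟨k, rfl⟩ := Nat.exists_eq_add_of_le' (show 1 ≤ n by omega)
    have hgap := hf.hasGap (k := k) h
    obtain ⟨i, a, c, hac⟩ := hregF.exists_consecutiveEdges hS (Set.range_nonempty f) hd2
    have hdle := degree_le_two_of_three_le_gap hS hgap (by omega) hregF hac.left_mem
      hac.right_mem (hgap _ _ _ hac)
    obtain ⟨a, rfl⟩ := hac.left_mem
    obtain ⟨c, rfl⟩ := hac.right_mem
    obtain ⟨v, p, hp, hconv, -⟩ := hf.exists_convex_cycle hac
    have h2 : ∀ v, (G.neighborSet v).ncard = 2 := by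
      intro v
      have := hd v
      rw [← SimpleGraph.card_neighborFinset_eq_degree, ← Set.ncard_coe_finset,
        SimpleGraph.coe_neighborFinset] at this
      omega
    obtain ⟨e⟩ := hp.nonempty_cycleGraph_iso hf.connected h2
    rw [h v p hp hconv] at e
    exact ⟨e.symm⟩
  · rintro ⟨φ⟩ v c hc -
    have hc' := hc.map (f := φ.toHom) φ.injective
    obtain ⟨e⟩ := hc'.nonempty_cycleGraph_iso
      ((SimpleGraph.Iso.connected_iff φ).1 hf.connected)
      (ncard_neighborSet_cycleGraph (by omega))
    have := Fintype.card_congr e.toEquiv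
    rwa [Fintype.card_fin, Fintype.card_fin, SimpleGraph.Walk.length_map] at this
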